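/- Let $\mathcal S=\bigoplus_{n\ge 0}\mathbb Q[S_n]$, with the product $\sigma\ast\beta=\sum\gamma$ for $\sigma\in S_n$, $\beta\in S_m$, where $\gamma$ runs over the permutations in $S_{n+m}$ such that $(\gamma(1),\dots,\gamma(n))$ is ordered as $(\sigma(1),\dots,\sigma(n))$ and $(\gamma(n+1),\dots,\gamma(n+m))$ is ordered as $(\beta(1),\dots,\beta(m))$, and with the Malvenuto–Reutenauer coproduct $\Delta(\sigma)=\sum_{i=0}^n \sigma_{|i}\otimes \mathrm{st}(\sigma_{|>i})$. Here $\sigma_{|i}$ (resp. $\sigma_{|>i}$) is the subsequence of $(\sigma(1),\dots,\sigma(n))$ of the values $\le i$ (resp. $>i$), and $\mathrm{st}$ subtracts $i$ from all values. A planar binary tree is either empty or of the form $T_1\vee T_2$ (a root with left branch $T_1$ and right branch $T_2$, each possibly empty). Let $PBT$ be the $\mathbb Q$-vector space with basis the planar binary trees, with the bilinear product given recursively by $T\ast U=(T\ast U_1)\vee U_2+T_1\vee(T_2\ast U)$ for $T=T_1\vee T_2$, $U=U_1\vee U_2$, and with the empty tree as unit $1$; it is an associative algebra. The $n$ vertices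 of a tree $T$ are labelled $1,\dots,n$ from left to right (left branch, then root, then right branch, recursively), and $i\le_T j$ means that $i$ lies on the path from the root to $j$. Identify $PBT$ with a subspace of $\mathcal S$ through the linear map $\kappa(T)=\sum_\sigma\sigma$, summed over the $\sigma\in S_n$ such that $i\le_T j$ implies $\sigma(i)\ge\sigma(j)$ (the linearisations of $T$). A set $V$ (possibly empty) of vertices of a nonempty tree $T$ is admissible if it does not contain the root and $v<_T w$ holds for no $v,w\in V$. For $V=\{v_1,\dots,v_k\}$ admissible, with the $v_i$ in the order of their labels, let $T_i$ be the subtree of all vertices $v\ge_T v_i$, let $T'_V=T_1\ast\cdots\ast T_k$ (with $T'_\emptyset=1$), and let $T_V$ be the tree containing the root that remains after $T_1,\dots,T_k$ have been pruned. Then $\kappa$ is an injective morphism of unital algebras, and the coproduct $\Delta$ of $\mathcal S$ restricts to $PBT$: there is a linear map $\Delta:PBT\to PBT\otimes PBT$ with $(\kappa\otimes\kappa)\circ\Delta=\Delta\circ\kappa$. With this coproduct the algebra $PBT$ is a Hopf algebra, and for every nonempty tree $T$ $$\Delta(T)=T\otimes 1+\sum_V T'_V\otimes T_V,$$ where $V$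 runs over all admissible sets of vertices of $T$. Moreover, with the opposite coproduct $\Delta^{\mathrm{op}}=\tau\circ\Delta$, $\tau(x\otimes y)=y\otimes x$, the algebra $PBT$ is also a Hopf algebra, and for every nonempty tree $T$ $$\Delta^{\mathrm{op}}(T)=1\otimes T+\sum_V T_V\otimes T'_V .$$ -/

import Mathlib

open scoped TensorProduct

noncomputable section

/-! ### The algebra and the coproduct of permutations -/

/-- The rational vector space `⨁ₙ ℚ[Sₙ]` with basis all permutations of `{1, …, n}`, `n ≥ 0`;
the set `{1, …, n}` is modelled by `Fin n = {0, …, n - 1}`. -/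
def PermAlg : Type := (Σ n : ℕ, Equiv.Perm (Fin n)) →₀ ℚ

namespace PermAlg

instance : AddCommGroup PermAlg :=
  inferInstanceAs (AddCommGroup ((Σ n : ℕ, Equiv.Perm (Fin n)) →₀ ℚ))

instance : Module ℚ PermAlg :=
  inferInstanceAs (Module ℚ ((Σ n : ℕ, Equiv.Perm (Fin n)) →₀ ℚ))

/-- The basis element given by a permutation. -/
def of {n : ℕ} (σ : Equiv.Perm (Fin n)) : PermAlg := Finsupp.single ⟨n, σ⟩ (1 : ℚ)

/-- Linear extension of a map defined on permutations. -/
def lift {M : Type*} [AddCommGroup M] [Module ℚ M]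
    (f : (Σ n : ℕ, Equiv.Perm (Fin n)) → M) : PermAlg →ₗ[ℚ] M :=
  Finsupp.linearCombination ℚ f

open Classical in
/-- The product `σ ∗ β` of two permutations: the sum of all `γ ∈ S_{n+m}` whose first `n` values
are ordered as those of `σ` and whose last `m` values are ordered as those of `β`. -/
def permMul {n m : ℕ} (σ : Equiv.Perm (Fin n)) (β : Equiv.Perm (Fin m)) : PermAlg :=
  ∑ γ : Equiv.Perm (Fin (n + m)) with
    (∀ i j : Fin n, γ (Fin.castAdd m i) < γ (Fin.castAdd m j) ↔ σ i < σ j) ∧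
    (∀ i j : Fin m, γ (Fin.natAdd n i) < γ (Fin.natAdd n j) ↔ β i < β j),
    of γ

/-- The bilinear product `∗` on the space of permutations. -/
def mul : PermAlg →ₗ[ℚ] PermAlg →ₗ[ℚ] PermAlg :=
  lift fun σ => lift fun β => permMul σ.2 β.2

/-- The unit: the permutation of the empty set. -/
def one : PermAlg := of (1 : Equiv.Perm (Fin 0))

/-- The standardization of the subsequence of `(σ(1), …, σ(n))` formed by the entries at the
positions in `s`, as a permutation of `{1, …, |s|}`: both the positions and the values that
occur are renumbered increasingly. -/
def standardize {n : ℕ} (σ : Equiv.Perm (Fin n)) (s : Finset (Fin n)) :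
    Equiv.Perm (Fin s.card) :=
  ((s.orderIsoOfFin rfl).toEquiv.trans
    (σ.subtypeEquiv (p := fun x => x ∈ s) (q := fun x => x ∈ s.map σ.toEmbedding)
      (fun a => by simp))).trans
    ((s.map σ.toEmbedding).orderIsoOfFin (Finset.card_map _)).toEquiv.symm

/-- The Malvenuto–Reutenauer coproduct of a permutation, `∑_{i=0}^n σ_{|i} ⊗ st(σ_{|>i})`, where
`σ_{|i}` is the subsequence of the values among the first `i` integers (it is already standard)
and `σ_{|>i}` is the subsequence of the other values. -/
def permComul {n : ℕ} (σ : Equiv.Perm (Fin n)) : PermAlg ⊗[ℚ] PermAlg :=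
  ∑ i ∈ Finset.range (n + 1),
    of (standardize σ {p | (σ p : ℕ) < i}) ⊗ₜ[ℚ] of (standardize σ {p | i ≤ (σ p : ℕ)})

/-- The Malvenuto–Reutenauer coproduct. -/
def comul : PermAlg →ₗ[ℚ] PermAlg ⊗[ℚ] PermAlg := lift fun σ => permComul σ.2

end PermAlg

/-! ### Planar binary trees

The vertices of a tree `T` with `n` vertices are identified with their labels, which are
`0, …, n - 1` from left to right: the left branch comes first, then the root, then the right
branch. -/

/-- A planar binary tree (possibly empty): a nonempty one is `T₁ ∨ T₂`, with a root, a left branch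
`T₁` and a right branch `T₂`. -/
abbrev PlanarTree : Type := BinaryTree Unit

namespace PlanarTree

open BinaryTree

/-- The order `≤_T` on labels: `i ≤_T j` if the vertex `i` lies on the path from the root to the
vertex `j`. The root is the least element. -/
def le : PlanarTree → ℕ → ℕ → Prop
  | nil, _, _ => False
  | node _ l r, i, j =>
      (i = l.numNodes ∧ j < l.numNodes + r.numNodes + 1) ∨
      (i < l.numNodes ∧ j < l.numNodes ∧ le l i j) ∨
      (l.numNodes < i ∧ l.numNodes < j ∧ le r (i - (l.numNodes + 1)) (j - (l.numNodes + 1)))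

/-- The strict order `<_T`. -/
def lt (T : PlanarTree) (i j : ℕ) : Prop := le T i j ∧ i ≠ j

/-- The label of the root of a nonempty tree. -/
def rootLabel : PlanarTree → ℕ
  | nil => 0
  | node _ l _ => l.numNodes

/-- The subtree consisting of the vertex `v` and all vertices above it. -/
def subtreeAt : PlanarTree → ℕ → PlanarTree
  | nil, _ => nil
  | node _ l r, v =>
      if v < l.numNodes then subtreeAt l v
      else if v = l.numNodes then node () l r
      else subtreeAt r (v - (l.numNodes + 1))

/-- The tree `T_V` that remains when the subtrees rooted at the vertices in `V` are pruned. -/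
def trunk : PlanarTree → Set ℕ → PlanarTree
  | nil, _ => nil
  | node _ l r, V =>
      open Classical in
      if l.numNodes ∈ V then nil
      else node () (trunk l V) (trunk r {v | v + (l.numNodes + 1) ∈ V})

open Classical in
/-- The admissible sets of vertices of `T`: those which do not contain the root and whose elements
are pairwise incomparable for `<_T`. -/
def admissible (T : PlanarTree) : Finset (Finset ℕ) :=
  {V ∈ (Finset.range T.numNodes).powerset |
    rootLabel T ∉ V ∧ ∀ v ∈ V, ∀ w ∈ V, ¬ lt T v w}

open Classical in
/-- The set `S_T` of linearisations of `T`: a permutation `σ` stands for the total order on the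
labels in which `σ⁻¹(1) ≫ σ⁻¹(2) ≫ ⋯ ≫ σ⁻¹(n)`, that is `i ≪ j` means `σ(j) < σ(i)`, and it
belongs to `S_T` if this total order refines `≤_T`. -/
def linearisations (T : PlanarTree) : Finset (Equiv.Perm (Fin T.numNodes)) :=
  {σ | ∀ i j : Fin T.numNodes, le T i j → σ j ≤ σ i}

end PlanarTree

/-! ### The algebra of planar binary trees -/

/-- The rational vector space with basis the planar binary trees. -/
def PBT : Type := PlanarTree →₀ ℚ

namespace PBT

open BinaryTree

instance : AddCommGroup PBT := inferInstanceAs (AddCommGroup (PlanarTree →₀ ℚ))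

instance : Module ℚ PBT := inferInstanceAs (Module ℚ (PlanarTree →₀ ℚ))

/-- The basis element given by a tree. -/
def of (T : PlanarTree) : PBT := Finsupp.single T (1 : ℚ)

/-- Linear extension of a map defined on trees. -/
def lift {M : Type*} [AddCommGroup M] [Module ℚ M] (f : PlanarTree → M) : PBT →ₗ[ℚ] M :=
  Finsupp.linearCombination ℚ f

/-- The bilinear extension of the grafting `T₁ ∨ T₂`. -/
def graft : PBT →ₗ[ℚ] PBT →ₗ[ℚ] PBT := lift fun T => lift fun U => of (node () T U)

/-- The product of trees: `T ∗ U = (T ∗ U₁) ∨ U₂ + T₁ ∨ (T₂ ∗ U)` for `T = T₁ ∨ T₂` and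
`U = U₁ ∨ U₂`, with the empty tree as unit. -/
def treeMul : PlanarTree → PlanarTree → PBT
  | nil, U => of U
  | node a l r, nil => of (node a l r)
  | node a l r, node b l' r' =>
      graft (treeMul (node a l r) l') (of r') + graft (of l) (treeMul r (node b l' r'))
  termination_by T U => T.numNodes + U.numNodes
  decreasing_by all_goals simp only [numNodes]; omega

/-- The bilinear extension of the product of trees. -/
def mulMap : PBT →ₗ[ℚ] PBT →ₗ[ℚ] PBT := lift fun T => lift fun U => treeMul T U

theorem lift_of {M : Type*} [AddCommGroup M] [Module ℚ M] (f : PlanarTree → M) (T : PlanarTree) :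
    lift f (of T) = f T :=
  (Finsupp.linearCombination_single ℚ (1 : ℚ) T).trans (one_smul _ _)

theorem hom_ext {M : Type*} [AddCommGroup M] [Module ℚ M] {f g : PBT →ₗ[ℚ] M}
    (h : ∀ T, f (of T) = g (of T)) : f = g :=
  Finsupp.lhom_ext' fun T => LinearMap.ext_ring (h T)

theorem mulMap_of (T U : PlanarTree) : mulMap (of T) (of U) = treeMul T U := by
  simp [mulMap, lift_of]

theorem graft_of (T U : PlanarTree) : graft (of T) (of U) = of (node () T U) := by
  simp [graft, lift_of]

theorem one_mulMap (x : PBT) : mulMap (of nil) x = x := by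
  have : mulMap (of nil) = LinearMap.id := hom_ext fun T => by
    simp [mulMap_of, treeMul]
  simp [this]

theorem mulMap_one (x : PBT) : mulMap x (of nil) = x := by
  have : mulMap.flip (of nil) = LinearMap.id := hom_ext fun T => by
    cases T <;> simp [mulMap_of, treeMul]
  simpa using LinearMap.congr_fun this x

theorem induction_on {p : PBT → Prop} (x : PBT) (h_zero : p 0) (h_of : ∀ T, p (of T))
    (h_add : ∀ x y, p x → p y → p (x + y)) (h_smul : ∀ (c : ℚ) x, p x → p (c • x)) : p x := by
  refine Finsupp.induction_linear (motive := p) x h_zero h_add fun T c => ?_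
  have : (Finsupp.single T c : PlanarTree →₀ ℚ) = c • Finsupp.single T (1 : ℚ) := by simp
  rw [this]
  exact h_smul c _ (h_of T)

theorem mulMap_graft (x y z w : PBT) :
    mulMap (graft x y) (graft z w) =
      graft (mulMap (graft x y) z) w + graft x (mulMap y (graft z w)) := by
  induction x using induction_on with
  | h_zero => simp
  | h_add x x' hx hx' => simp only [map_add, LinearMap.add_apply, hx, hx']; abel
  | h_smul c x hx => simp only [map_smul, LinearMap.smul_apply, hx, smul_add]
  | h_of X =>
  induction y using induction_on with
  | h_zero => simp
  | h_add x x' hx hx' => simp only [map_add, LinearMap.add_apply, hx, hx']; abel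
  | h_smul c x hx => simp only [map_smul, LinearMap.smul_apply, hx, smul_add]
  | h_of Y =>
  induction z using induction_on with
  | h_zero => simp
  | h_add x x' hx hx' => simp only [map_add, LinearMap.add_apply, hx, hx']; abel
  | h_smul c x hx => simp only [map_smul, LinearMap.smul_apply, hx, smul_add]
  | h_of Z =>
  induction w using induction_on with
  | h_zero => simp
  | h_add x x' hx hx' => simp only [map_add, hx, hx']; abel
  | h_smul c x hx => simp only [map_smul, hx, smul_add]
  | h_of W => simp only [graft_of, mulMap_of, treeMul]

theorem mulMap_assoc_of (n : ℕ) : ∀ T U W : PlanarTree,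
    T.numNodes + U.numNodes + W.numNodes = n →
      mulMap (mulMap (of T) (of U)) (of W) = mulMap (of T) (mulMap (of U) (of W)) := by
  induction n using Nat.strong_induction_on with
  | _ n ih =>
  rintro (_ | ⟨⟨⟩, t, t'⟩) (_ | ⟨⟨⟩, u, u'⟩) (_ | ⟨⟨⟩, w, w'⟩) h <;>
    try simp only [one_mulMap, mulMap_one]
  have h₁ := ih _ (by simp only [numNodes] at h ⊢; omega) (node () t t') (node () u u') w rfl
  have h₂ := ih _ (by simp only [numNodes] at h ⊢; omega) t' (node () u u') (node () w w') rfl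
  simp only [← graft_of, mulMap_graft, map_add, LinearMap.add_apply] at h₁ h₂ ⊢
  rw [h₂, ← h₁]
  simp only [map_add, LinearMap.add_apply]
  abel

theorem mulMap_assoc (x y z : PBT) : mulMap (mulMap x y) z = mulMap x (mulMap y z) := by
  induction x using induction_on with
  | h_zero => simp
  | h_add x x' hx hx' => simp only [map_add, LinearMap.add_apply, hx, hx']
  | h_smul c x hx => simp only [map_smul, LinearMap.smul_apply, hx]
  | h_of X =>
  induction y using induction_on with
  | h_zero => simp
  | h_add x x' hx hx' => simp only [map_add, LinearMap.add_apply, hx, hx']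
  | h_smul c x hx => simp only [map_smul, LinearMap.smul_apply, hx]
  | h_of Y =>
  induction z using induction_on with
  | h_zero => simp
  | h_add x x' hx hx' => simp only [map_add, hx, hx']
  | h_smul c x hx => simp only [map_smul, hx]
  | h_of Z => exact mulMap_assoc_of _ X Y Z rfl

instance : Ring PBT :=
  { (inferInstance : AddCommGroup PBT) with
    mul := fun x y => mulMap x y
    one := of nil
    mul_assoc := mulMap_assoc
    one_mul := one_mulMap
    mul_one := mulMap_one
    left_distrib := fun x y z => map_add (mulMap x) y z
    right_distrib := fun x y z => LinearMap.map_add₂ mulMap x y z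
    zero_mul := fun x => LinearMap.map_zero₂ mulMap x
    mul_zero := fun x => map_zero (mulMap x) }

instance : Algebra ℚ PBT :=
  Algebra.ofModule (fun c x y => LinearMap.map_smul₂ mulMap c x y)
    (fun c x y => map_smul (mulMap x) c y)

/-- The embedding `κ` of planar binary trees into permutations, which sends a tree to the sum of its
linearisations. -/
def kappa : PBT →ₗ[ℚ] PermAlg := lift fun T => ∑ σ ∈ T.linearisations, PermAlg.of σ

/-- The product `T'_V = T₁ ∗ ⋯ ∗ T_k` of the subtrees of `T` rooted at the vertices in `V`, taken
in the order of the labels. -/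
def prunedProduct (T : PlanarTree) (V : Finset ℕ) : PBT :=
  ((V.sort (· ≤ ·)).map fun v => of (T.subtreeAt v)).prod

end PBT

/-- The linear map `Δ` makes the given algebra `A` a Hopf algebra: there is a Hopf algebra structure
on `A` whose underlying algebra is the given one and whose coproduct is `Δ`. -/
def IsHopfCoproduct {R A : Type*} [CommRing R] [Ring A] [alg : Algebra R A]
    (Δ : A →ₗ[R] A ⊗[R] A) : Prop :=
  ∃ H : HopfAlgebra R A, H.toAlgebra = alg ∧ HEq H.comul Δ

end

noncomputable section

/-! ### The Hopf algebra of planar binary trees -/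

namespace PBT

open BinaryTree LinearMap WithConv

/-! The coproduct is defined on trees by the recursion `Δ(l ∨ r) = (l ∨ r) ⊗ 1 + ∑ (l' ∗ r') ⊗ (l''
∨ r'')`, where `Δ l = ∑ l' ⊗ l''` and `Δ r = ∑ r' ⊗ r''`. Since the product is also recursive in the
grafting, multiplicativity (`comul_mul`) and coassociativity (`comul_coassoc`) follow by induction.
Both structures are graded by the number of vertices and the degree zero part is spanned by `1`, so
an antipode exists as a geometric series for convolution (`isHopfCoproduct_of_homogeneous`). The
criterion applies equally to the opposite coproduct.

Unfolding the recursion gives the pruning formula: a set of pairwise incomparable vertices is either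
the root alone, which yields `T ⊗ 1`, or a pair of such sets in the two branches
(`comul_of_eq_sum_antichains`).

The comparison with permutations is by duality. Cutting a word at its leftmost greatest letter,
recursively, attaches a tree to it, its shape. The linearisations of `T` are exactly the
permutations whose word has shape `T`, so the coefficient of a permutation in `κ(x)` is the
functional `wordCoeff` of its word at `x` (`orderCoeff_kappa`). On the tree side the product is dual
to cutting a word in two (`wordCoeff_mul`) and the coproduct is dual to shuffling small letters with
large ones (`sum_shuffles_wordCoeff`); both follow by cutting at the greatest letter. Permutations
obey the same two rules (`orderCoeff_mul`, `orderCoeffTensor_comul`), and their coefficients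
determine an element. Injectivity holds because each tree is the shape of some word with distinct
letters and no word has two shapes. -/

theorem of_nil : of nil = 1 := rfl

theorem graft_mul_graft (x y z w : PBT) :
    graft x y * graft z w = graft (graft x y * z) w + graft x (y * graft z w) :=
  mulMap_graft x y z w

/-- The bilinear map `(a ⊗ b, c ⊗ d) ↦ (a ∗ c) ⊗ (b ∨ d)`. -/
def mulGraft : PBT ⊗[ℚ] PBT →ₗ[ℚ] PBT ⊗[ℚ] PBT →ₗ[ℚ] PBT ⊗[ℚ] PBT :=
  TensorProduct.map₂ (LinearMap.mul ℚ PBT) graft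

@[simp]
theorem mulGraft_tmul (a b c d : PBT) :
    mulGraft (a ⊗ₜ b) (c ⊗ₜ d) = (a * c) ⊗ₜ graft b d := rfl

/-- The coproduct of a tree. -/
def comulTree : PlanarTree → PBT ⊗[ℚ] PBT
  | nil => 1
  | node _ l r => of (node () l r) ⊗ₜ 1 + mulGraft (comulTree l) (comulTree r)

/-- The coproduct on planar binary trees. -/
def comul : PBT →ₗ[ℚ] PBT ⊗[ℚ] PBT := lift comulTree

theorem comul_of (T : PlanarTree) : comul (of T) = comulTree T := lift_of _ _

theorem comul_one : comul 1 = 1 := comul_of nil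

/-- The recursion in bilinear form; multiplicativity, coassociativity and the counit laws all rest
on it. -/
theorem comul_graft (x y : PBT) :
    comul (graft x y) = graft x y ⊗ₜ 1 + mulGraft (comul x) (comul y) := by
  have h : graft.compr₂ comul =
      graft.compr₂ ((TensorProduct.mk ℚ PBT PBT).flip 1) + mulGraft.compl₁₂ comul comul :=
    hom_ext fun T => hom_ext fun U => by
      simp [graft_of, comul_of, comulTree]
  exact LinearMap.congr_fun₂ h x y

theorem mulGraft_tmul_one_mul (x : PBT) (a b : PBT ⊗[ℚ] PBT) :
    mulGraft ((x ⊗ₜ 1) * a) b = (x ⊗ₜ 1) * mulGraft a b := by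
  induction a with
  | zero => simp
  | add a a' ha ha' => simp only [mul_add, map_add, LinearMap.add_apply, ha, ha']
  | tmul p q =>
    induction b with
    | zero => simp
    | add b b' hb hb' => simp only [mul_add, map_add, hb, hb']
    | tmul r s => simp [mul_assoc]

theorem mulGraft_mul_tmul_one (x : PBT) (a b : PBT ⊗[ℚ] PBT) :
    mulGraft a (b * (x ⊗ₜ 1)) = mulGraft a b * (x ⊗ₜ 1) := by
  induction a with
  | zero => simp
  | add a a' ha ha' => simp only [add_mul, map_add, LinearMap.add_apply, ha, ha']
  | tmul p q =>
    induction b with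
    | zero => simp
    | add b b' hb hb' => simp only [add_mul, map_add, hb, hb']
    | tmul r s => simp [mul_assoc]

/-- The tensor counterpart of `graft_mul_graft`: the second factors follow that rule, while the
first factors only use associativity. -/
theorem mulGraft_mul_mulGraft (a b c d : PBT ⊗[ℚ] PBT) :
    mulGraft a b * mulGraft c d =
      mulGraft (mulGraft a b * c) d + mulGraft a (b * mulGraft c d) := by
  induction a with
  | zero => simp
  | add a a' ha ha' =>
    simp only [add_mul, map_add, LinearMap.add_apply, ha, ha']; abel
  | tmul p q =>
  induction b with
  | zero => simp
  | add a a' ha ha' => simp only [add_mul, map_add, LinearMap.add_apply, ha, ha']; abel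
  | tmul r s =>
  induction c with
  | zero => simp
  | add a a' ha ha' => simp only [mul_add, map_add, LinearMap.add_apply, ha, ha']; abel
  | tmul t u =>
  induction d with
  | zero => simp
  | add a a' ha ha' => simp only [mul_add, map_add, ha, ha']; abel
  | tmul v w =>
    simp [graft_mul_graft, TensorProduct.tmul_add, mul_assoc]

theorem comul_mul_of (n : ℕ) : ∀ T U : PlanarTree, T.numNodes + U.numNodes = n →
    comul (of T * of U) = comul (of T) * comul (of U) := by
  induction n using Nat.strong_induction_on with
  | _ n ih =>
  rintro (_ | ⟨⟨⟩, t, t'⟩) (_ | ⟨⟨⟩, u, u'⟩) h <;>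
    try simp only [of_nil, one_mul, mul_one, comul_one]
  -- The two summands of `T ∗ U` contain the smaller products `T ∗ u` and `t' ∗ U`, so the induction
  -- is on the total number of vertices.
  have h₁ := ih _ (by simp only [numNodes] at h ⊢; omega) (node () t t') u rfl
  have h₂ := ih _ (by simp only [numNodes] at h ⊢; omega) t' (node () u u') rfl
  simp only [← graft_of] at h₁ h₂ ⊢
  rw [graft_mul_graft, map_add, comul_graft, comul_graft (of t) (_ * _), h₁, h₂,
    comul_graft, comul_graft]
  simp only [add_mul, mul_add, map_add,
    LinearMap.add_apply, mulGraft_tmul_one_mul, mulGraft_mul_tmul_one,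
    mulGraft_mul_mulGraft, Algebra.TensorProduct.tmul_mul_tmul, mul_one,
    graft_mul_graft, TensorProduct.add_tmul]
  abel

theorem comul_mul (x y : PBT) : comul (x * y) = comul x * comul y := by
  have h : (LinearMap.mul ℚ PBT).compr₂ comul =
      (LinearMap.mul ℚ (PBT ⊗[ℚ] PBT)).compl₁₂ comul comul :=
    hom_ext fun T => hom_ext fun U => comul_mul_of _ T U rfl
  exact LinearMap.congr_fun₂ h x y

/-! ### Coassociativity. -/

theorem assoc_mul_tmul_graft (u v : PBT ⊗[ℚ] PBT) (q q' : PBT) :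
    TensorProduct.assoc ℚ PBT PBT PBT ((u * v) ⊗ₜ graft q q') =
      TensorProduct.map₂ (LinearMap.mul ℚ PBT) mulGraft
        (TensorProduct.assoc ℚ PBT PBT PBT (u ⊗ₜ q))
        (TensorProduct.assoc ℚ PBT PBT PBT (v ⊗ₜ q')) := by
  induction u with
  | zero => simp
  | add a a' ha ha' =>
    simp only [add_mul, TensorProduct.add_tmul, map_add, LinearMap.add_apply, ha, ha']
  | tmul p r =>
  induction v with
  | zero => simp
  | add a a' ha ha' => simp only [mul_add, TensorProduct.add_tmul, map_add, ha, ha']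
  | tmul s t => simp

theorem assoc_rTensor_comul_mulGraft (a b : PBT ⊗[ℚ] PBT) :
    TensorProduct.assoc ℚ PBT PBT PBT (comul.rTensor PBT (mulGraft a b)) =
      TensorProduct.map₂ (LinearMap.mul ℚ PBT) mulGraft
        (TensorProduct.assoc ℚ PBT PBT PBT (comul.rTensor PBT a))
        (TensorProduct.assoc ℚ PBT PBT PBT (comul.rTensor PBT b)) := by
  induction a with
  | zero => simp
  | add a a' ha ha' => simp only [map_add, LinearMap.add_apply, ha, ha']
  | tmul p q =>
  induction b with
  | zero => simp
  | add a a' ha ha' => simp only [map_add, ha, ha']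
  | tmul r s => simp only [mulGraft_tmul, rTensor_tmul, comul_mul, assoc_mul_tmul_graft]

/-- Here `comul` meets a graft, which contributes the extra term ending in `1`. In `comul_coassoc`
it cancels against the part `mulGraft _ _ ⊗ 1` of `Δ(T) ⊗ 1`. -/
theorem lTensor_comul_mulGraft (a b : PBT ⊗[ℚ] PBT) :
    comul.lTensor PBT (mulGraft a b) =
      TensorProduct.assoc ℚ PBT PBT PBT (mulGraft a b ⊗ₜ 1) +
      TensorProduct.map₂ (LinearMap.mul ℚ PBT) mulGraft
        (comul.lTensor PBT a) (comul.lTensor PBT b) := by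
  induction a with
  | zero => simp
  | add a a' ha ha' =>
    simp only [map_add, LinearMap.add_apply, TensorProduct.add_tmul, ha, ha']; abel
  | tmul p q =>
  induction b with
  | zero => simp
  | add a a' ha ha' => simp only [map_add, TensorProduct.add_tmul, ha, ha']; abel
  | tmul r s => simp [comul_graft, TensorProduct.tmul_add]

theorem comul_coassoc :
    TensorProduct.assoc ℚ PBT PBT PBT ∘ₗ comul.rTensor PBT ∘ₗ comul =
      comul.lTensor PBT ∘ₗ comul := by
  refine hom_ext fun T => ?_
  induction T with
  | nil =>
    simp [of_nil, comul_one, Algebra.TensorProduct.one_def]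
  | node a l r hl hr =>
    simp only [LinearMap.comp_apply, LinearEquiv.coe_coe] at hl hr ⊢
    rw [← graft_of, comul_graft, map_add, map_add, map_add, assoc_rTensor_comul_mulGraft,
      lTensor_comul_mulGraft, hl, hr, rTensor_tmul, lTensor_tmul, comul_graft, comul_one,
      TensorProduct.add_tmul, map_add, add_assoc, Algebra.TensorProduct.one_def,
      TensorProduct.assoc_tmul]

/-! ### The counit. -/

/-- The counit: the coefficient of the empty tree. -/
def counit : PBT →ₗ[ℚ] ℚ := lift fun T => if T = nil then 1 else 0

theorem counit_of (T : PlanarTree) : counit (of T) = if T = nil then 1 else 0 := lift_of _ _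

theorem counit_one : counit 1 = 1 := by simp [← of_nil, counit_of]

theorem counit_graft (x y : PBT) : counit (graft x y) = 0 := by
  have h : graft.compr₂ counit = 0 := hom_ext fun T => hom_ext fun U => by
    simp [graft_of, counit_of]
  exact LinearMap.congr_fun₂ h x y

theorem counit_mul (x y : PBT) : counit (x * y) = counit x * counit y := by
  have h : (LinearMap.mul ℚ PBT).compr₂ counit =
      (LinearMap.mul ℚ ℚ).compl₁₂ counit counit := by
    refine hom_ext fun T => hom_ext fun U => ?_
    obtain _ | ⟨⟨⟩, t, t'⟩ := T
    · simp [of_nil, counit_one]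
    obtain _ | ⟨⟨⟩, u, u'⟩ := U
    · simp [of_nil, counit_one]
    · simp [← graft_of, graft_mul_graft, counit_graft]
  exact LinearMap.congr_fun₂ h x y

theorem rTensor_counit_mulGraft (a b : PBT ⊗[ℚ] PBT) :
    counit.rTensor PBT (mulGraft a b) =
      TensorProduct.map₂ (LinearMap.mul ℚ ℚ) graft
        (counit.rTensor PBT a) (counit.rTensor PBT b) := by
  induction a with
  | zero => simp
  | add a a' ha ha' => simp only [map_add, LinearMap.add_apply, ha, ha']
  | tmul p q =>
  induction b with
  | zero => simp
  | add a a' ha ha' => simp only [map_add, ha, ha']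
  | tmul r s => simp [counit_mul]

theorem lTensor_counit_mulGraft (a b : PBT ⊗[ℚ] PBT) :
    counit.lTensor PBT (mulGraft a b) = 0 := by
  induction a with
  | zero => simp
  | add a a' ha ha' => simp only [map_add, LinearMap.add_apply, ha, ha', add_zero]
  | tmul p q =>
  induction b with
  | zero => simp
  | add a a' ha ha' => simp only [map_add, ha, ha', add_zero]
  | tmul r s => simp [counit_graft]

theorem rTensor_counit_comp_comul :
    counit.rTensor PBT ∘ₗ comul = TensorProduct.mk ℚ _ _ 1 := by
  refine hom_ext fun T => ?_
  induction T with
  | nil => simp [of_nil, comul_one, Algebra.TensorProduct.one_def, counit_one]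
  | node a l r hl hr =>
    simp only [LinearMap.comp_apply] at hl hr ⊢
    rw [← graft_of, comul_graft, map_add, rTensor_counit_mulGraft, hl, hr]
    simp [counit_graft]

theorem lTensor_counit_comp_comul :
    counit.lTensor PBT ∘ₗ comul = (TensorProduct.mk ℚ _ _).flip 1 := by
  refine hom_ext fun T => ?_
  cases T with
  | nil => simp [of_nil, comul_one, Algebra.TensorProduct.one_def, counit_one]
  | node a l r =>
    rw [LinearMap.comp_apply, ← graft_of, comul_graft, map_add, lTensor_counit_mulGraft]
    simp [counit_one]

/-! ### The grading and the antipode. -/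

/-- The homogeneous component of degree `n` of the algebra of trees. -/
def homogeneous (n : ℕ) : Submodule ℚ PBT :=
  Submodule.span ℚ (of '' {T | T.numNodes = n})

/-- The homogeneous component of degree `n` of the tensor square. -/
def homogeneousTensor (n : ℕ) : Submodule ℚ (PBT ⊗[ℚ] PBT) :=
  Submodule.span ℚ
    {z | ∃ i j x y, i + j = n ∧ x ∈ homogeneous i ∧ y ∈ homogeneous j ∧ z = x ⊗ₜ[ℚ] y}

theorem of_mem_homogeneous (T : PlanarTree) : of T ∈ homogeneous T.numNodes :=
  Submodule.subset_span ⟨T, rfl, rfl⟩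

theorem tmul_mem_homogeneousTensor {m n k : ℕ} {x y : PBT} (hx : x ∈ homogeneous m)
    (hy : y ∈ homogeneous n) (h : m + n = k) : x ⊗ₜ y ∈ homogeneousTensor k :=
  Submodule.subset_span ⟨m, n, x, y, h, hx, hy, rfl⟩

/-- A scalar can be absorbed in the first factor, which stays homogeneous, so no separate case for
scalars is needed. -/
theorem homogeneousTensor_induction {n : ℕ} {p : PBT ⊗[ℚ] PBT → Prop}
    (zero : p 0) (add : ∀ a b, p a → p b → p (a + b))
    (tmul : ∀ i j x y, i + j = n → x ∈ homogeneous i → y ∈ homogeneous j → p (x ⊗ₜ y))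
    {z : PBT ⊗[ℚ] PBT} (hz : z ∈ homogeneousTensor n) : p z := by
  refine Submodule.closure_induction (p := fun z _ => p z) zero (fun a b _ _ => add a b) ?_ hz
  rintro c _ ⟨i, j, x, y, h, hx, hy, rfl⟩
  rw [TensorProduct.smul_tmul']
  exact tmul i j _ y h (Submodule.smul_mem _ c hx) hy

theorem linearMap_mem_of_homogeneous {M : Type*} [AddCommGroup M] [Module ℚ M] {n : ℕ}
    (f : PBT →ₗ[ℚ] M) (S : Submodule ℚ M) (h : ∀ T : PlanarTree, T.numNodes = n → f (of T) ∈ S)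
    {x : PBT} (hx : x ∈ homogeneous n) : f x ∈ S := by
  have : homogeneous n ≤ S.comap f := by
    rw [homogeneous, Submodule.span_le]
    rintro _ ⟨T, hT, rfl⟩
    exact h T hT
  exact this hx

theorem graft_mem_homogeneous {m n : ℕ} {x y : PBT} (hx : x ∈ homogeneous m)
    (hy : y ∈ homogeneous n) : graft x y ∈ homogeneous (m + n + 1) := by
  refine linearMap_mem_of_homogeneous (graft x) _ (fun U hU => ?_) hy
  refine linearMap_mem_of_homogeneous (graft.flip (of U)) _ (fun T hT => ?_) hx
  subst hU hT
  rw [LinearMap.flip_apply, graft_of]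
  exact of_mem_homogeneous (node () T U)

theorem of_mul_of_mem_homogeneous (n : ℕ) : ∀ T U : PlanarTree, T.numNodes + U.numNodes = n →
    of T * of U ∈ homogeneous n := by
  induction n using Nat.strong_induction_on with
  | _ n ih =>
  rintro (_ | ⟨⟨⟩, t, t'⟩) (_ | ⟨⟨⟩, u, u'⟩) rfl
  · simpa [of_nil] using of_mem_homogeneous nil
  · simpa [of_nil] using of_mem_homogeneous (node () u u')
  · simpa [of_nil] using of_mem_homogeneous (node () t t')
  have h₁ := graft_mem_homogeneous
    (ih _ (by simp only [numNodes]; omega) (node () t t') u rfl) (of_mem_homogeneous u')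
  have h₂ := graft_mem_homogeneous (of_mem_homogeneous t)
    (ih _ (by simp only [numNodes]; omega) t' (node () u u') rfl)
  rw [← graft_of, ← graft_of, graft_mul_graft, graft_of, graft_of]
  refine add_mem ?_ ?_
  · convert h₁ using 2
    simp only [numNodes]; omega
  · convert h₂ using 2
    simp only [numNodes]; omega

theorem mul_mem_homogeneous {m n : ℕ} {x y : PBT} (hx : x ∈ homogeneous m)
    (hy : y ∈ homogeneous n) : x * y ∈ homogeneous (m + n) := by
  refine linearMap_mem_of_homogeneous (LinearMap.mul ℚ PBT x) _ (fun U hU => ?_) hy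
  refine linearMap_mem_of_homogeneous ((LinearMap.mul ℚ PBT).flip (of U)) _ (fun T hT => ?_) hx
  subst hU hT
  exact of_mul_of_mem_homogeneous _ T U rfl

theorem mulGraft_mem_homogeneousTensor {m n : ℕ} {a b : PBT ⊗[ℚ] PBT}
    (ha : a ∈ homogeneousTensor m) (hb : b ∈ homogeneousTensor n) :
    mulGraft a b ∈ homogeneousTensor (m + n + 1) := by
  refine homogeneousTensor_induction
    (p := fun a => mulGraft a b ∈ homogeneousTensor (m + n + 1)) (by simp)
    (fun a a' h h' => ?_) (fun i j x y e hx hy => ?_) ha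
  · rw [map_add, LinearMap.add_apply]
    exact add_mem h h'
  refine homogeneousTensor_induction
    (p := fun b => mulGraft (x ⊗ₜ y) b ∈ homogeneousTensor (m + n + 1)) (by simp)
    (fun a a' h h' => ?_) (fun i' j' x' y' e' hx' hy' => ?_) hb
  · rw [map_add]
    exact add_mem h h'
  rw [mulGraft_tmul]
  exact tmul_mem_homogeneousTensor (mul_mem_homogeneous hx hx') (graft_mem_homogeneous hy hy')
    (by omega)

theorem comul_of_mem_homogeneousTensor (T : PlanarTree) :
    comul (of T) ∈ homogeneousTensor T.numNodes := by
  induction T with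
  | nil =>
    rw [of_nil, comul_one]
    exact tmul_mem_homogeneousTensor (of_mem_homogeneous nil) (of_mem_homogeneous nil) rfl
  | node a l r hl hr =>
    rw [← graft_of, comul_graft, graft_of]
    exact add_mem (tmul_mem_homogeneousTensor (of_mem_homogeneous _) (of_mem_homogeneous nil) rfl)
      (mulGraft_mem_homogeneousTensor hl hr)

theorem comm_mem_homogeneousTensor {n : ℕ} {a : PBT ⊗[ℚ] PBT} (ha : a ∈ homogeneousTensor n) :
    TensorProduct.comm ℚ PBT PBT a ∈ homogeneousTensor n := by
  refine homogeneousTensor_induction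
    (p := fun a => TensorProduct.comm ℚ PBT PBT a ∈ homogeneousTensor n) (by simp)
    (fun a a' h h' => ?_) (fun i j x y e hx hy => ?_) ha
  · rw [map_add]
    exact add_mem h h'
  · exact tmul_mem_homogeneousTensor hy hx (by omega)

/-- In a graded coalgebra on trees, the difference of the unit and the identity is locally
nilpotent for the convolution product. -/
theorem convPow_eq_zero_of_homogeneous [Coalgebra ℚ PBT] {g : WithConv (PBT →ₗ[ℚ] PBT)}
    (hg : g (of nil) = 0)
    (hΔ : ∀ T, Coalgebra.comul (R := ℚ) (of T) ∈ homogeneousTensor T.numNodes) (k : ℕ) :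
    ∀ n < k, ∀ x ∈ homogeneous n, (g ^ k) x = 0 := by
  induction k with
  | zero => simp
  | succ k ih =>
    intro n hn x hx
    refine linearMap_mem_of_homogeneous (g ^ (k + 1)).ofConv ⊥ (fun T hT => ?_) hx
    rw [Submodule.mem_bot, pow_succ]
    change (g ^ k * g) (of T) = 0
    rw [convMul_apply]
    refine homogeneousTensor_induction (p := fun z => mul' ℚ PBT
      (TensorProduct.map (g ^ k).ofConv g.ofConv z) = 0) (by simp)
      (fun a b ha hb => by rw [map_add, map_add, ha, hb, add_zero])
      (fun i j x y e hx hy => ?_) (hΔ T)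
    rw [TensorProduct.map_tmul, mul'_apply]
    -- In degree zero there is only the empty tree, killed by `g`; if `j > 0`, then the degree `i`
    -- of `x` is less than `k`.
    rcases Nat.eq_zero_or_pos j with rfl | hj
    · have : g y = 0 := by
        refine linearMap_mem_of_homogeneous g.ofConv ⊥ (fun U hU => ?_) hy
        cases U with
        | nil => exact hg
        | node => simp at hU
      exact (congrArg _ this).trans (mul_zero _)
    · have : (g ^ k) x = 0 := ih i (by omega) x hx
      exact (congrArg (· * _) this).trans (zero_mul _)

/-- A graded bialgebra structure on trees, with counit the coefficient of the empty tree, has an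
antipode. -/
theorem isHopfCoproduct_of_homogeneous (Δ : PBT →ₗ[ℚ] PBT ⊗[ℚ] PBT)
    (coassoc : TensorProduct.assoc ℚ PBT PBT PBT ∘ₗ Δ.rTensor PBT ∘ₗ Δ = Δ.lTensor PBT ∘ₗ Δ)
    (rTensor_counit : counit.rTensor PBT ∘ₗ Δ = TensorProduct.mk ℚ _ _ 1)
    (lTensor_counit : counit.lTensor PBT ∘ₗ Δ = (TensorProduct.mk ℚ _ _).flip 1)
    (map_one : Δ 1 = 1) (map_mul : ∀ x y, Δ (x * y) = Δ x * Δ y)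
    (hΔ : ∀ T, Δ (of T) ∈ homogeneousTensor T.numNodes) : IsHopfCoproduct Δ := by
  let C : Coalgebra ℚ PBT :=
    { comul := Δ
      counit := counit
      coassoc := coassoc
      rTensor_counit_comp_comul := rTensor_counit
      lTensor_counit_comp_comul := lTensor_counit }
  let B : Bialgebra ℚ PBT := Bialgebra.mk' ℚ PBT counit_one (fun {a b} => counit_mul a b)
    map_one (fun {a b} => map_mul a b)
  let g : WithConv (PBT →ₗ[ℚ] PBT) := 1 - toConv LinearMap.id
  have hg : g (of nil) = 0 := by
    change algebraMap ℚ PBT (counit (of nil)) - of nil = 0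
    rw [of_nil, counit_one, _root_.map_one, sub_self]
  have hpow := convPow_eq_zero_of_homogeneous hg hΔ
  have hid : toConv LinearMap.id = 1 - g := (sub_sub_cancel _ _).symm
  -- The inverse of `id = 1 - g` for convolution is the sum of all `g ^ k`; on a tree with `n`
  -- vertices the terms with `k > n` vanish.
  let S : PBT →ₗ[ℚ] PBT := lift fun T => ∑ k ∈ Finset.range (T.numNodes + 1), (g ^ k) (of T)
  have hS : ∀ i n : ℕ, i ≤ n → ∀ x ∈ homogeneous i,
      S x = (∑ k ∈ Finset.range (n + 1), g ^ k).ofConv x := by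
    intro i n hin x hx
    rw [← sub_eq_zero, ← LinearMap.sub_apply]
    refine linearMap_mem_of_homogeneous _ ⊥ (fun T hT => ?_) hx
    subst hT
    rw [Submodule.mem_bot, LinearMap.sub_apply, lift_of, ofConv_sum, LinearMap.sum_apply,
      sub_eq_zero]
    refine Finset.sum_subset (Finset.range_mono (by omega)) fun k _ hk => ?_
    exact hpow k _ (by simpa using hk) _ (of_mem_homogeneous T)
  -- The remainder of the geometric sum vanishes on `T`, which leaves the convolution unit.
  have hgeom : ∀ T : PlanarTree, (1 - g ^ (T.numNodes + 1)) (of T) =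
      algebraMap ℚ PBT (counit (of T)) := fun T => by
    change algebraMap ℚ PBT (counit (of T)) - (g ^ (T.numNodes + 1)) (of T) = _
    rw [hpow _ _ (Nat.lt_succ_self _) _ (of_mem_homogeneous T), sub_zero]
  refine ⟨{ B with
    antipode := S
    mul_antipode_rTensor_comul := hom_ext fun T => ?_
    mul_antipode_lTensor_comul := hom_ext fun T => ?_ }, rfl, HEq.rfl⟩
  · refine Eq.trans ?_ (hgeom T)
    rw [← geom_sum_mul_neg, ← hid, convMul_apply]
    refine homogeneousTensor_induction (p := fun z => mul' ℚ PBT (S.rTensor PBT z) =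
      mul' ℚ PBT (TensorProduct.map _ _ z)) (by simp)
      (fun a b ha hb => by simp only [map_add, ha, hb])
      (fun i j x y e hx hy => ?_) (hΔ T)
    rw [rTensor_tmul, TensorProduct.map_tmul, hS i T.numNodes (by omega) x hx]
    rfl
  · refine Eq.trans ?_ (hgeom T)
    rw [← mul_neg_geom_sum, ← hid, convMul_apply]
    refine homogeneousTensor_induction (p := fun z => mul' ℚ PBT (S.lTensor PBT z) =
      mul' ℚ PBT (TensorProduct.map _ _ z)) (by simp)
      (fun a b ha hb => by simp only [map_add, ha, hb])
      (fun i j x y e hx hy => ?_) (hΔ T)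
    rw [lTensor_tmul, TensorProduct.map_tmul, hS j T.numNodes (by omega) y hy]
    rfl

theorem isHopfCoproduct_comul : IsHopfCoproduct comul :=
  isHopfCoproduct_of_homogeneous comul comul_coassoc rTensor_counit_comp_comul
    lTensor_counit_comp_comul comul_one comul_mul comul_of_mem_homogeneousTensor

/-! ### The opposite coproduct. -/

/-- The reversal `a ⊗ (b ⊗ c) ↦ c ⊗ (b ⊗ a)` of the tensor cube. -/
def reverseTensor : PBT ⊗[ℚ] (PBT ⊗[ℚ] PBT) →ₗ[ℚ] PBT ⊗[ℚ] (PBT ⊗[ℚ] PBT) :=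
  TensorProduct.assoc ℚ PBT PBT PBT ∘ₗ
    (TensorProduct.comm ℚ PBT (PBT ⊗[ℚ] PBT)).toLinearMap ∘ₗ
    (TensorProduct.comm ℚ PBT PBT).toLinearMap.lTensor PBT

theorem isHopfCoproduct_comm_comp_comul :
    IsHopfCoproduct ((TensorProduct.comm ℚ PBT PBT).toLinearMap ∘ₗ comul) := by
  set τ := (TensorProduct.comm ℚ PBT PBT).toLinearMap
  refine isHopfCoproduct_of_homogeneous _ ?_ ?_ ?_ ?_ ?_ ?_
  -- Reversing the tensor cube exchanges the two sides of coassociativity: each side for the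
  -- opposite coproduct is the reversal of the other side for `comul`.
  · have h₁ : TensorProduct.assoc ℚ PBT PBT PBT ∘ₗ (τ ∘ₗ comul).rTensor PBT ∘ₗ τ =
        reverseTensor ∘ₗ comul.lTensor PBT := by
      ext x y
      rfl
    have h₂ : (τ ∘ₗ comul).lTensor PBT ∘ₗ τ =
        reverseTensor ∘ₗ TensorProduct.assoc ℚ PBT PBT PBT ∘ₗ comul.rTensor PBT := by
      refine TensorProduct.ext' fun x y => ?_
      have : ∀ u : PBT ⊗[ℚ] PBT, y ⊗ₜ τ u =
          reverseTensor (TensorProduct.assoc ℚ PBT PBT PBT (u ⊗ₜ y)) := fun u => by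
        induction u with
        | zero => simp
        | add a b ha hb => simp only [map_add, TensorProduct.tmul_add, TensorProduct.add_tmul, ha, hb]
        | tmul a b => rfl
      exact this (comul x)
    refine LinearMap.ext fun x => ?_
    have h₁' := LinearMap.congr_fun h₁ (comul x)
    have h₂' := LinearMap.congr_fun h₂ (comul x)
    exact h₁'.trans ((congrArg reverseTensor (LinearMap.congr_fun comul_coassoc x)).symm.trans
      h₂'.symm)
  · have h : counit.rTensor PBT ∘ₗ τ =
        (TensorProduct.comm ℚ PBT ℚ).toLinearMap ∘ₗ counit.lTensor PBT := by
      ext x y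
      rfl
    rw [← LinearMap.comp_assoc, h, LinearMap.comp_assoc, lTensor_counit_comp_comul]
    rfl
  · have h : counit.lTensor PBT ∘ₗ τ =
        (TensorProduct.comm ℚ ℚ PBT).toLinearMap ∘ₗ counit.rTensor PBT := by
      ext x y
      rfl
    rw [← LinearMap.comp_assoc, h, LinearMap.comp_assoc, rTensor_counit_comp_comul]
    rfl
  · rw [LinearMap.comp_apply, comul_one]
    rfl
  · intro x y
    rw [LinearMap.comp_apply, comul_mul]
    exact map_mul (Algebra.TensorProduct.comm ℚ PBT PBT) _ _
  · exact fun T => comm_mem_homogeneousTensor (comul_of_mem_homogeneousTensor T)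

end PBT

/-! ### The coproduct of a tree in terms of admissible sets -/

namespace PlanarTree

open BinaryTree

open Classical in
/-- The sets of pairwise incomparable vertices of a tree. -/
def antichains (T : PlanarTree) : Finset (Finset ℕ) :=
  {V ∈ (Finset.range T.numNodes).powerset | ∀ v ∈ V, ∀ w ∈ V, ¬ lt T v w}

theorem mem_antichains {T : PlanarTree} {V : Finset ℕ} :
    V ∈ T.antichains ↔ (∀ v ∈ V, v < T.numNodes) ∧ ∀ v ∈ V, ∀ w ∈ V, ¬ lt T v w := by
  simp [antichains, Finset.subset_iff]

theorem mem_admissible {T : PlanarTree} {V : Finset ℕ} :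
    V ∈ T.admissible ↔ (∀ v ∈ V, v < T.numNodes) ∧ rootLabel T ∉ V ∧
      ∀ v ∈ V, ∀ w ∈ V, ¬ lt T v w := by
  simp [admissible, Finset.subset_iff]

/-- The set of vertices of a nonempty tree formed by a set of vertices of the left branch and a set
of vertices of the right branch. -/
def joinVertices (l : PlanarTree) (V W : Finset ℕ) : Finset ℕ :=
  V ∪ W.map (addRightEmbedding (l.numNodes + 1))

theorem mem_joinVertices {l : PlanarTree} {V W : Finset ℕ} {v : ℕ} :
    v ∈ joinVertices l V W ↔ v ∈ V ∨ ∃ w ∈ W, w + (l.numNodes + 1) = v := by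
  simp [joinVertices]

theorem antichains_nil : antichains nil = {∅} := by
  ext V
  rw [mem_antichains, Finset.mem_singleton, Finset.eq_empty_iff_forall_notMem]
  constructor
  · exact fun h v hv => absurd (h.1 v hv) (Nat.not_lt_zero v)
  · exact fun h => ⟨fun v hv => absurd hv (h v), fun v hv => absurd hv (h v)⟩

/-- The root lies below every other vertex, so a set of incomparable vertices containing it is a
singleton. -/
theorem antichains_node (l r : PlanarTree) :
    antichains (node () l r) = insert {l.numNodes} (admissible (node () l r)) := by
  ext V
  rw [Finset.mem_insert, mem_antichains, mem_admissible]
  constructor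
  · rintro ⟨h, h'⟩
    by_cases hV : l.numNodes ∈ V
    · refine Or.inl (Finset.eq_singleton_iff_unique_mem.2 ⟨hV, fun v hv => ?_⟩)
      by_contra hne
      have := h v hv
      exact h' _ hV _ hv ⟨Or.inl ⟨rfl, this⟩, fun e => hne e.symm⟩
    · exact Or.inr ⟨h, hV, h'⟩
  · rintro (rfl | ⟨h, _, h'⟩)
    · refine ⟨by simp only [Finset.mem_singleton, forall_eq, numNodes]; omega, ?_⟩
      simp [lt]
    · exact ⟨h, h'⟩

theorem root_notMem_admissible (l r : PlanarTree) :
    {l.numNodes} ∉ admissible (node () l r) := by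
  simp [mem_admissible, rootLabel]

theorem le_node_left {l r : PlanarTree} {i j : ℕ} (hi : i < l.numNodes) (hj : j < l.numNodes) :
    le (node () l r) i j ↔ le l i j := by
  simp only [le]
  constructor
  · rintro (h | h | h)
    · omega
    · exact h.2.2
    · omega
  · exact fun h => Or.inr (Or.inl ⟨hi, hj, h⟩)

theorem le_node_right {l r : PlanarTree} {i j : ℕ} :
    le (node () l r) (i + (l.numNodes + 1)) (j + (l.numNodes + 1)) ↔ le r i j := by
  simp only [le, Nat.add_sub_cancel]
  constructor
  · rintro (h | h | h)
    · omega
    · omega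
    · exact h.2.2
  · exact fun h => Or.inr (Or.inr ⟨by omega, by omega, h⟩)

theorem joinVertices_mem_admissible {l r : PlanarTree} {V W : Finset ℕ}
    (hV : V ∈ l.antichains) (hW : W ∈ r.antichains) :
    joinVertices l V W ∈ admissible (node () l r) := by
  rw [mem_antichains] at hV hW
  rw [mem_admissible]
  simp only [mem_joinVertices, rootLabel]
  refine ⟨?_, ?_, ?_⟩
  · rintro v (hv | ⟨w, hw, rfl⟩)
    · have := hV.1 v hv
      simp only [numNodes]; omega
    · have := hW.1 w hw
      simp only [numNodes]; omega
  · rintro (hv | ⟨w, -, hw⟩)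
    · exact absurd (hV.1 _ hv) (lt_irrefl _)
    · omega
  · rintro v (hv | ⟨v, hv, rfl⟩) w (hw | ⟨w, hw, rfl⟩) ⟨hle, hne⟩
    · exact hV.2 v hv w hw ⟨(le_node_left (hV.1 v hv) (hV.1 w hw)).1 hle, hne⟩
    · have := hV.1 v hv
      simp only [le] at hle
      omega
    · have := hV.1 w hw
      simp only [le] at hle
      omega
    · exact hW.2 v hv w hw ⟨le_node_right.1 hle, fun e => hne (by rw [e])⟩

/-- Vertices in different branches are never comparable, so incomparability can be tested in each
branch separately. -/
theorem sum_admissible_node {M : Type*} [AddCommMonoid M] (l r : PlanarTree)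
    (f : Finset ℕ → M) :
    ∑ V ∈ admissible (node () l r), f V =
      ∑ V ∈ l.antichains, ∑ W ∈ r.antichains, f (joinVertices l V W) := by
  classical
  rw [← Finset.sum_product']
  symm
  refine Finset.sum_bij' (fun p _ => joinVertices l p.1 p.2)
    -- The inverse keeps the labels left of the root and shifts those right of it back to labels of
    -- `r`.
    (fun V _ => (V.filter (· < l.numNodes),
      (Finset.range r.numNodes).filter (· + (l.numNodes + 1) ∈ V))) ?_ ?_ ?_ ?_ ?_
  · rintro ⟨V, W⟩ h
    rw [Finset.mem_product] at h
    exact joinVertices_mem_admissible h.1 h.2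
  · intro V hV
    rw [mem_admissible] at hV
    rw [Finset.mem_product, mem_antichains, mem_antichains]
    simp only [Finset.mem_filter, Finset.mem_range]
    refine ⟨⟨fun v hv => hv.2, ?_⟩, fun v hv => hv.1, ?_⟩
    · rintro v ⟨hv, hvl⟩ w ⟨hw, hwl⟩ ⟨hle, hne⟩
      exact hV.2.2 v hv w hw ⟨(le_node_left hvl hwl).2 hle, hne⟩
    · rintro v ⟨_, hv⟩ w ⟨_, hw⟩ ⟨hle, hne⟩
      exact hV.2.2 _ hv _ hw ⟨le_node_right.2 hle, fun e => hne (by omega)⟩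
  · rintro ⟨V, W⟩ h
    rw [Finset.mem_product, mem_antichains, mem_antichains] at h
    obtain ⟨⟨hV, _⟩, hW, _⟩ := h
    dsimp only at hV hW
    refine Prod.ext (Finset.ext fun v => ?_) (Finset.ext fun v => ?_)
    · simp only [Finset.mem_filter, mem_joinVertices]
      constructor
      · rintro ⟨h | ⟨w, _, h⟩, hv⟩
        · exact h
        · omega
      · exact fun h => ⟨Or.inl h, hV v h⟩
    · simp only [Finset.mem_filter, mem_joinVertices, Finset.mem_range]
      constructor
      · rintro ⟨hv, h | ⟨w, hw, h⟩⟩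
        · have := hV _ h
          omega
        · rwa [← Nat.add_right_cancel h]
      · exact fun h => ⟨hW v h, Or.inr ⟨v, h, rfl⟩⟩
  · intro V hV
    rw [mem_admissible] at hV
    obtain ⟨hV, hroot, _⟩ := hV
    ext v
    simp only [mem_joinVertices, Finset.mem_filter, Finset.mem_range]
    constructor
    · rintro (h | ⟨w, h, rfl⟩)
      · exact h.1
      · exact h.2
    · intro hv
      have h₁ := hV v hv
      have h₂ : v ≠ l.numNodes := fun e => hroot (by rwa [e] at hv)
      simp only [numNodes] at h₁
      by_cases h : v < l.numNodes
      · exact Or.inl ⟨hv, h⟩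
      · have e : v - (l.numNodes + 1) + (l.numNodes + 1) = v := by omega
        exact Or.inr ⟨v - (l.numNodes + 1), ⟨by omega, by rwa [e]⟩, e⟩
  · exact fun _ _ => rfl

/-- Needed because `trunk` passes the whole set to the left branch, including labels too large to be
vertices there. -/
theorem trunk_congr (T : PlanarTree) : ∀ V W : Set ℕ,
    (∀ v < T.numNodes, v ∈ V ↔ v ∈ W) → trunk T V = trunk T W := by
  induction T with
  | nil => intros; rfl
  | node a l r hl hr =>
    intro V W h
    simp only [numNodes] at h
    simp only [trunk]
    rw [hl V W fun v hv => h v (by omega),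
      hr {v | v + (l.numNodes + 1) ∈ V} {v | v + (l.numNodes + 1) ∈ W}
        fun v hv => h (v + (l.numNodes + 1)) (by omega)]
    have hl := h l.numNodes (by omega)
    by_cases hV : l.numNodes ∈ V
    · rw [if_pos hV, if_pos (hl.1 hV)]
    · rw [if_neg hV, if_neg (hl.not.1 hV)]

theorem trunk_singleton_root (l r : PlanarTree) :
    trunk (node () l r) ↑({l.numNodes} : Finset ℕ) = nil := by
  simp [trunk]

theorem trunk_joinVertices {l : PlanarTree} (r : PlanarTree) {V : Finset ℕ} (W : Finset ℕ)
    (hV : V ∈ l.antichains) :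
    trunk (node () l r) ↑(joinVertices l V W) = node () (trunk l ↑V) (trunk r ↑W) := by
  rw [mem_antichains] at hV
  have h : l.numNodes ∉ (↑(joinVertices l V W) : Set ℕ) := by
    rw [Finset.mem_coe, mem_joinVertices]
    rintro (h | ⟨w, _, h⟩)
    · exact absurd (hV.1 _ h) (lt_irrefl _)
    · omega
  simp only [trunk, if_neg h]
  congr 1
  · refine trunk_congr l _ _ fun v hv => ?_
    rw [Finset.mem_coe, Finset.mem_coe, mem_joinVertices]
    constructor
    · rintro (h | ⟨w, _, h⟩)
      · exact h
      · omega
    · exact Or.inl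
  · refine trunk_congr r _ _ fun v _ => ?_
    rw [Set.mem_ofPred_eq, Finset.mem_coe, Finset.mem_coe, mem_joinVertices]
    constructor
    · rintro (h | ⟨w, hw, h⟩)
      · have := hV.1 _ h
        omega
      · rwa [← Nat.add_right_cancel h]
    · exact fun h => Or.inr ⟨v, h, rfl⟩

/-- All labels of the left branch precede those of the right one; hence the ordered product of
pruned subtrees factors. -/
theorem sort_joinVertices {l : PlanarTree} {V : Finset ℕ} (W : Finset ℕ)
    (hV : V ∈ l.antichains) :
    (joinVertices l V W).sort (· ≤ ·) =
      V.sort (· ≤ ·) ++ (W.sort (· ≤ ·)).map (· + (l.numNodes + 1)) := by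
  rw [mem_antichains] at hV
  set L := V.sort (· ≤ ·) ++ (W.sort (· ≤ ·)).map (· + (l.numNodes + 1)) with hL
  have hmem : ∀ v, v ∈ L ↔ v ∈ joinVertices l V W := by
    intro v
    simp [hL, mem_joinVertices]
  have hlt : L.Pairwise (· < ·) := by
    rw [hL, List.pairwise_append]
    refine ⟨V.sortedLT_sort.pairwise, ?_, ?_⟩
    · rw [List.pairwise_map]
      exact W.sortedLT_sort.pairwise.imp fun h => by omega
    · intro a ha b hb
      have := hV.1 a ((Finset.mem_sort _).1 ha)
      obtain ⟨w, _, rfl⟩ := List.mem_map.1 hb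
      omega
  have hfin : L.toFinset = joinVertices l V W := by
    ext v
    rw [List.mem_toFinset, hmem]
  rw [← hfin]
  exact (List.toFinset_sort (· ≤ ·) (hlt.imp fun h => h.ne)).2 (hlt.imp fun h => h.le)

end PlanarTree

namespace PBT

open BinaryTree PlanarTree

theorem prunedProduct_joinVertices {l : PlanarTree} (r : PlanarTree) {V : Finset ℕ} (W : Finset ℕ)
    (hV : V ∈ l.antichains) :
    prunedProduct (node () l r) (joinVertices l V W) = prunedProduct l V * prunedProduct r W := by
  rw [prunedProduct, sort_joinVertices W hV, List.map_append, List.prod_append, List.map_map,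
    prunedProduct, prunedProduct]
  congr 2
  · refine List.map_congr_left fun v hv => ?_
    have := (mem_antichains.1 hV).1 v ((Finset.mem_sort _).1 hv)
    simp [subtreeAt, this]
  · refine List.map_congr_left fun v _ => ?_
    have h₁ : ¬ v + (l.numNodes + 1) < l.numNodes := by omega
    have h₂ : v + (l.numNodes + 1) ≠ l.numNodes := by omega
    simp only [Function.comp_apply, subtreeAt, if_neg h₁, if_neg h₂, Nat.add_sub_cancel]

theorem prunedProduct_singleton_root (l r : PlanarTree) :
    prunedProduct (node () l r) {l.numNodes} = of (node () l r) := by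
  simp [prunedProduct, subtreeAt]

/-- Allowing the root in `V` makes the formula stable under the recursion: the singleton of the root
gives `T ⊗ 1`, and pairs of antichains in the branches give the `mulGraft` term. -/
theorem comul_of_eq_sum_antichains (T : PlanarTree) :
    comul (of T) = ∑ V ∈ T.antichains, prunedProduct T V ⊗ₜ[ℚ] of (T.trunk V) := by
  induction T with
  | nil =>
    rw [antichains_nil, Finset.sum_singleton, of_nil, comul_one]
    simp [prunedProduct, trunk, of_nil, Algebra.TensorProduct.one_def]
  | node a l r hl hr =>
    rw [antichains_node, Finset.sum_insert (root_notMem_admissible l r),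
      prunedProduct_singleton_root, trunk_singleton_root, ← graft_of, comul_graft, hl, hr,
      sum_admissible_node, of_nil]
    simp only [map_sum, LinearMap.sum_apply]
    rw [Finset.sum_comm]
    congr 1
    refine Finset.sum_congr rfl fun V hV => Finset.sum_congr rfl fun W _ => ?_
    rw [mulGraft_tmul, prunedProduct_joinVertices r W hV, trunk_joinVertices r W hV, graft_of]

theorem comul_of_eq_sum_admissible (T : PlanarTree) (hT : T ≠ nil) :
    comul (of T) = of T ⊗ₜ[ℚ] (1 : PBT) +
      ∑ V ∈ T.admissible, prunedProduct T V ⊗ₜ[ℚ] of (T.trunk V) := by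
  obtain _ | ⟨⟨⟩, l, r⟩ := T
  · exact absurd rfl hT
  · rw [comul_of_eq_sum_antichains, antichains_node,
      Finset.sum_insert (root_notMem_admissible l r), prunedProduct_singleton_root,
      trunk_singleton_root, of_nil]

end PBT

/-! ### Words and their shapes -/

namespace PlanarTree

open BinaryTree

/-- A tree is the shape of a word if its root corresponds to the (leftmost) greatest letter of the
word and its branches are the shapes of the words on the left and on the right of this letter. -/
def IsShape : PlanarTree → List ℕ → Prop
  | nil, w => w = []
  | node _ l r, w => ∃ u m v, w = u ++ m :: v ∧ (∀ x ∈ u, x < m) ∧ (∀ x ∈ v, x ≤ m) ∧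
      IsShape l u ∧ IsShape r v

end PlanarTree

/-- The strict inequality on the left and the weak one on the right single out the leftmost maximum,
so distinct letters are not required. -/
theorem List.append_max_cons_inj {u u' v v' : List ℕ} {m m' : ℕ} (hu : ∀ x ∈ u, x < m)
    (hv : ∀ x ∈ v, x ≤ m) (hu' : ∀ x ∈ u', x < m') (hv' : ∀ x ∈ v', x ≤ m')
    (h : u ++ m :: v = u' ++ m' :: v') : u = u' ∧ m = m' ∧ v = v' := by
  rcases List.append_eq_append_iff.1 h with ⟨_ | ⟨a, s⟩, h₁, h₂⟩ | ⟨_ | ⟨a, s⟩, h₁, h₂⟩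
  · simp_all
  · simp only [List.cons_append, List.cons.injEq] at h₂
    have h₃ := hu' a (by simp [h₁])
    have h₄ := hv m' (by simp [h₂.2])
    omega
  · simp_all
  · simp only [List.cons_append, List.cons.injEq] at h₂
    have h₃ := hu a (by simp [h₁])
    have h₄ := hv' m (by simp [h₂.2])
    omega

theorem List.exists_append_max_cons {w : List ℕ} (hw : w ≠ []) :
    ∃ u m v, w = u ++ m :: v ∧ (∀ x ∈ u, x < m) ∧ ∀ x ∈ v, x ≤ m := by
  induction w with
  | nil => exact absurd rfl hw
  | cons a t ih =>
    by_cases ht : t = []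
    · exact ⟨[], a, [], by simp [ht], by simp, by simp⟩
    · obtain ⟨u, m, v, rfl, hu, hv⟩ := ih ht
      by_cases ham : a < m
      · exact ⟨a :: u, m, v, rfl, by simpa [ham] using hu, hv⟩
      · refine ⟨[], a, u ++ m :: v, rfl, by simp, fun x hx => ?_⟩
        rw [List.mem_append, List.mem_cons] at hx
        rcases hx with hx | rfl | hx
        · have := hu x hx; omega
        · omega
        · have := hv x hx; omega

theorem List.sum_take_drop_append_cons {α M : Type*} [AddCommMonoid M] (u v : List α) (m : α)
    (f : List α → List α → M) :
    ∑ i ∈ Finset.range ((u ++ m :: v).length + 1),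
        f ((u ++ m :: v).take i) ((u ++ m :: v).drop i) =
      ∑ i ∈ Finset.range (u.length + 1), f (u.take i) (u.drop i ++ m :: v) +
      ∑ i ∈ Finset.range (v.length + 1), f (u ++ m :: v.take i) (v.drop i) := by
  have h : (u ++ m :: v).length + 1 = (u.length + 1) + (v.length + 1) := by
    simp only [List.length_append, List.length_cons]; omega
  -- A cut is made either before the letter `m` or after it.
  rw [h, Finset.sum_range_add]
  congr 1
  · refine Finset.sum_congr rfl fun i hi => ?_
    have hi : i ≤ u.length := by simpa [Nat.lt_succ_iff] using hi
    rw [List.take_append_of_le_length hi, List.drop_append_of_le_length hi]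
  · refine Finset.sum_congr rfl fun i _ => ?_
    have e : u.length + 1 + i = u.length + (i + 1) := by omega
    rw [e, List.take_length_add_append, List.drop_length_add_append]
    rfl

namespace PlanarTree

open BinaryTree

theorem isShape_node_append_cons {l r : PlanarTree} {u v : List ℕ} {m : ℕ}
    (hu : ∀ x ∈ u, x < m) (hv : ∀ x ∈ v, x ≤ m) :
    IsShape (node () l r) (u ++ m :: v) ↔ IsShape l u ∧ IsShape r v := by
  constructor
  · rintro ⟨u', m', v', h, hu', hv', hl, hr⟩
    obtain ⟨rfl, rfl, rfl⟩ := List.append_max_cons_inj hu hv hu' hv' h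
    exact ⟨hl, hr⟩
  · exact fun h => ⟨u, m, v, rfl, hu, hv, h.1, h.2⟩

theorem not_isShape_node_nil (l r : PlanarTree) : ¬ IsShape (node () l r) [] := by
  rintro ⟨u, m, v, h, -⟩
  simp at h

theorem IsShape.unique {T : PlanarTree} : ∀ {U : PlanarTree} {w : List ℕ},
    IsShape T w → IsShape U w → T = U := by
  induction T with
  | nil =>
    rintro (_ | ⟨⟨⟩, l, r⟩) w rfl h
    · rfl
    · exact absurd h (not_isShape_node_nil l r)
  | node a l r hl hr =>
    rintro U _ ⟨u, m, v, rfl, hu, hv, hlu, hrv⟩ h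
    obtain _ | ⟨⟨⟩, l', r'⟩ := U
    · simp [IsShape] at h
    · rw [isShape_node_append_cons hu hv] at h
      rw [hl hlu h.1, hr hrv h.2]

theorem IsShape.length_eq {T : PlanarTree} : ∀ {w : List ℕ}, IsShape T w →
    w.length = T.numNodes := by
  induction T with
  | nil => rintro w rfl; rfl
  | node a l r hl hr =>
    rintro _ ⟨u, m, v, rfl, -, -, hlu, hrv⟩
    simp only [List.length_append, List.length_cons, hl hlu, hr hrv, numNodes]
    omega

theorem IsShape.map_add {T : PlanarTree} (k : ℕ) : ∀ {w : List ℕ}, IsShape T w →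
    IsShape T (w.map (· + k)) := by
  induction T with
  | nil => rintro w rfl; rfl
  | node a l r hl hr =>
    rintro _ ⟨u, m, v, rfl, hu, hv, hlu, hrv⟩
    refine ⟨u.map (· + k), m + k, v.map (· + k), by simp, ?_, ?_, hl hlu, hr hrv⟩
    · simpa using hu
    · simpa using hv

/-- Shapes see only the relative order of letters; this absorbs the shift made by standardization.
-/
theorem isShape_map_add {T : PlanarTree} (k : ℕ) : ∀ {w : List ℕ},
    IsShape T (w.map (· + k)) ↔ IsShape T w := by
  refine fun {w} => ⟨?_, IsShape.map_add k⟩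
  induction T generalizing w with
  | nil => exact fun h => by simpa [IsShape] using h
  | node a l r hl hr =>
    intro h
    have hw : w ≠ [] := by
      rintro rfl
      exact not_isShape_node_nil l r h
    obtain ⟨u, m, v, rfl, hu, hv⟩ := List.exists_append_max_cons hw
    rw [List.map_append, List.map_cons,
      isShape_node_append_cons (by simpa using hu) (by simpa using hv)] at h
    exact (isShape_node_append_cons hu hv).2 ⟨hl h.1, hr h.2⟩

theorem exists_nodup_isShape (T : PlanarTree) :
    ∃ w : List ℕ, w.Nodup ∧ (∀ x ∈ w, x < T.numNodes) ∧ IsShape T w := by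
  induction T with
  | nil => exact ⟨[], by simp, by simp, rfl⟩
  | node a l r hl hr =>
    obtain ⟨u, hu, hul, hlu⟩ := hl
    obtain ⟨v, hv, hvr, hrv⟩ := hr
    -- The left branch uses the letters below `l.numNodes`, the right branch the next `r.numNodes`
    -- ones, and the root the largest.
    refine ⟨u ++ (l.numNodes + r.numNodes) :: v.map (· + l.numNodes), ?_, ?_, ?_⟩
    · rw [List.nodup_append, List.nodup_cons]
      refine ⟨hu, ⟨?_, hv.map fun a b h => Nat.add_right_cancel h⟩, ?_⟩
      · rw [List.mem_map]
        rintro ⟨x, hx, h⟩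
        have := hvr x hx
        omega
      · rintro x hx y hy rfl
        have := hul x hx
        rcases List.mem_cons.1 hy with rfl | hy
        · omega
        · obtain ⟨z, -, rfl⟩ := List.mem_map.1 hy
          omega
    · intro x hx
      simp only [numNodes]
      rw [List.mem_append, List.mem_cons, List.mem_map] at hx
      rcases hx with hx | rfl | ⟨y, hy, rfl⟩
      · have := hul x hx
        omega
      · omega
      · have := hvr y hy
        omega
    · refine ⟨u, _, _, rfl, fun x hx => ?_, fun x hx => ?_, hlu, hrv.map_add _⟩
      · have := hul x hx
        omega
      · obtain ⟨y, hy, rfl⟩ := List.mem_map.1 hx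
        have := hvr y hy
        omega

end PlanarTree

/-! ### The product of trees is dual to cutting words. -/

namespace PBT

open BinaryTree PlanarTree

open Classical in
/-- The sum of the coefficients of the trees whose shape is a given word. -/
def wordCoeff (w : List ℕ) : PBT →ₗ[ℚ] ℚ := lift fun T => if IsShape T w then 1 else 0

open Classical in
theorem wordCoeff_of (w : List ℕ) (T : PlanarTree) :
    wordCoeff w (of T) = if IsShape T w then 1 else 0 := lift_of _ _

theorem wordCoeff_one (w : List ℕ) : wordCoeff w 1 = if w = [] then 1 else 0 := by
  classical
  rw [← of_nil, wordCoeff_of]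
  exact if_congr Iff.rfl rfl rfl

theorem wordCoeff_nil_graft (x y : PBT) : wordCoeff [] (graft x y) = 0 := by
  have h : graft.compr₂ (wordCoeff []) = 0 := hom_ext fun T => hom_ext fun U => by
    simp [graft_of, wordCoeff_of, not_isShape_node_nil]
  exact LinearMap.congr_fun₂ h x y

theorem wordCoeff_append_cons_graft {u v : List ℕ} {m : ℕ} (hu : ∀ x ∈ u, x < m)
    (hv : ∀ x ∈ v, x ≤ m) (x y : PBT) :
    wordCoeff (u ++ m :: v) (graft x y) = wordCoeff u x * wordCoeff v y := by
  have h : graft.compr₂ (wordCoeff (u ++ m :: v)) =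
      (LinearMap.mul ℚ ℚ).compl₁₂ (wordCoeff u) (wordCoeff v) :=
    hom_ext fun T => hom_ext fun U => by
      by_cases h₁ : IsShape T u <;> by_cases h₂ : IsShape U v <;>
        simp [graft_of, wordCoeff_of, isShape_node_append_cons hu hv, h₁, h₂]
  exact LinearMap.congr_fun₂ h x y

theorem wordCoeff_map_add (k : ℕ) (w : List ℕ) : wordCoeff (w.map (· + k)) = wordCoeff w :=
  hom_ext fun T => by
    classical
    rw [wordCoeff_of, wordCoeff_of]
    exact if_congr (isShape_map_add k) rfl rfl

theorem wordCoeff_one_mul (w : List ℕ) (y : PBT) :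
    ∑ i ∈ Finset.range (w.length + 1), wordCoeff (w.take i) 1 * wordCoeff (w.drop i) y =
      wordCoeff w y := by
  rw [Finset.sum_eq_single_of_mem 0 (by simp)]
  · simp [wordCoeff_one]
  · intro i hi h0
    rw [Finset.mem_range] at hi
    have : w.take i ≠ [] := by
      rw [Ne, List.take_eq_nil_iff]
      rintro (h | rfl)
      · exact h0 h
      · simp only [List.length_nil] at hi; omega
    rw [wordCoeff_one, if_neg this, zero_mul]

theorem wordCoeff_mul_one (w : List ℕ) (x : PBT) :
    ∑ i ∈ Finset.range (w.length + 1), wordCoeff (w.take i) x * wordCoeff (w.drop i) 1 =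
      wordCoeff w x := by
  rw [Finset.sum_eq_single_of_mem w.length (by simp)]
  · simp [wordCoeff_one]
  · intro i hi h0
    rw [Finset.mem_range] at hi
    have : w.drop i ≠ [] := by
      rw [Ne, List.drop_eq_nil_iff]
      omega
    rw [wordCoeff_one, if_neg this, mul_zero]

/-- Let `m` be the leftmost greatest letter of `w`. The cuts before `m` account for the summand `(T
∗ u) ∨ u'` of the product, and those after `m` for `t ∨ (t' ∗ U)`. -/
theorem wordCoeff_mul_of (n : ℕ) : ∀ (T U : PlanarTree) (w : List ℕ),
    T.numNodes + U.numNodes = n → wordCoeff w (of T * of U) =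
      ∑ i ∈ Finset.range (w.length + 1),
        wordCoeff (w.take i) (of T) * wordCoeff (w.drop i) (of U) := by
  induction n using Nat.strong_induction_on with
  | _ n ih =>
  intro T U w h
  obtain _ | ⟨⟨⟩, t, t'⟩ := T
  · rw [of_nil, wordCoeff_one_mul, one_mul]
  obtain _ | ⟨⟨⟩, u, u'⟩ := U
  · rw [of_nil, wordCoeff_mul_one, mul_one]
  by_cases hw : w = []
  · subst hw
    simp [← graft_of, graft_mul_graft, wordCoeff_nil_graft]
  obtain ⟨p, m, q, rfl, hp, hq⟩ := List.exists_append_max_cons hw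
  have h₁ := ih _ (by simp only [numNodes] at h ⊢; omega) (node () t t') u p rfl
  have h₂ := ih _ (by simp only [numNodes] at h ⊢; omega) t' (node () u u') q rfl
  rw [List.sum_take_drop_append_cons p q m
    fun a b => wordCoeff a (of (node () t t')) * wordCoeff b (of (node () u u'))]
  simp only [← graft_of] at h₁ h₂ ⊢
  rw [graft_mul_graft, map_add, wordCoeff_append_cons_graft hp hq,
    wordCoeff_append_cons_graft hp hq, h₁, h₂, Finset.sum_mul, Finset.mul_sum]
  congr 1
  · refine Finset.sum_congr rfl fun i _ => ?_
    rw [wordCoeff_append_cons_graft (fun x hx => hp x (List.mem_of_mem_drop hx)) hq, mul_assoc]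
  · refine Finset.sum_congr rfl fun i _ => ?_
    rw [wordCoeff_append_cons_graft hp (fun x hx => hq x (List.mem_of_mem_take hx)), mul_assoc]

theorem wordCoeff_mul (w : List ℕ) (x y : PBT) :
    wordCoeff w (x * y) =
      ∑ i ∈ Finset.range (w.length + 1), wordCoeff (w.take i) x * wordCoeff (w.drop i) y := by
  have h : (LinearMap.mul ℚ PBT).compr₂ (wordCoeff w) =
      ∑ i ∈ Finset.range (w.length + 1),
        (LinearMap.mul ℚ ℚ).compl₁₂ (wordCoeff (w.take i)) (wordCoeff (w.drop i)) := by
    refine hom_ext fun T => hom_ext fun U => ?_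
    simpa [LinearMap.sum_apply] using wordCoeff_mul_of _ T U w rfl
  simpa [LinearMap.sum_apply] using LinearMap.congr_fun₂ h x y

end PBT

/-! ### Shuffles -/

/-- The words whose letters less than `a` form the word `u` and whose other letters form the
word `v`. -/
def shuffles (a : ℕ) (u v : List ℕ) : Finset (List ℕ) :=
  {w ∈ (u ++ v).permutations.toFinset | w.filter (· < a) = u ∧ w.filter (a ≤ ·) = v}

/-- The list of permutations in the definition only ensures finiteness: the two filter conditions
already force `w` to be a rearrangement of `u ++ v`. -/
theorem mem_shuffles {a : ℕ} {u v w : List ℕ} :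
    w ∈ shuffles a u v ↔ w.filter (· < a) = u ∧ w.filter (a ≤ ·) = v := by
  simp only [shuffles, Finset.mem_filter, List.mem_toFinset, List.mem_permutations,
    and_iff_right_iff_imp]
  rintro ⟨rfl, rfl⟩
  have := List.filter_append_perm (fun x => decide (x < a)) w
  simpa only [← decide_not, not_lt] using this.symm

theorem shuffles_nil_right {a : ℕ} {u : List ℕ} (hu : ∀ x ∈ u, x < a) : shuffles a u [] = {u} := by
  ext w
  rw [mem_shuffles, Finset.mem_singleton]
  constructor
  · rintro ⟨h, h'⟩
    rw [← h, eq_comm, List.filter_eq_self]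
    intro x hx
    simpa using List.filter_eq_nil_iff.1 h' x hx
  · rintro rfl
    exact ⟨List.filter_eq_self.2 (by simpa using hu), List.filter_eq_nil_iff.2 (by simpa using hu)⟩

/-- The letters of `u` are less than `a ≤ m`, so `m` remains the leftmost greatest letter of each
shuffle. Cutting there cuts `u` at some place `i` and leaves two independent shuffles. -/
theorem sum_shuffles_append_cons {M : Type*} [AddCommMonoid M] {a m : ℕ} {u v₁ v₂ : List ℕ}
    (hu : ∀ x ∈ u, x < a) (hm : a ≤ m) (hv₁ : ∀ x ∈ v₁, x < m) (hv₂ : ∀ x ∈ v₂, x ≤ m)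
    (f : List ℕ → M) :
    ∑ w ∈ shuffles a u (v₁ ++ m :: v₂), f w =
      ∑ i ∈ Finset.range (u.length + 1), ∑ w₁ ∈ shuffles a (u.take i) v₁,
        ∑ w₂ ∈ shuffles a (u.drop i) v₂, f (w₁ ++ m :: w₂) := by
  have hlt : ∀ {i w₁}, w₁ ∈ shuffles a (u.take i) v₁ → ∀ x ∈ w₁, x < m := by
    intro i w₁ h x hx
    rw [mem_shuffles] at h
    by_cases hxa : x < a
    · omega
    · exact hv₁ x (h.2 ▸ List.mem_filter.2 ⟨hx, by simpa using hxa⟩)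
  have hle : ∀ {i w₂}, w₂ ∈ shuffles a (u.drop i) v₂ → ∀ x ∈ w₂, x ≤ m := by
    intro i w₁ h x hx
    rw [mem_shuffles] at h
    by_cases hxa : x < a
    · omega
    · exact hv₂ x (h.2 ▸ List.mem_filter.2 ⟨hx, by simpa using hxa⟩)
  simp only [← Finset.sum_product']
  rw [Finset.sum_sigma']
  symm
  refine Finset.sum_bij (fun p _ => p.2.1 ++ m :: p.2.2) ?_ ?_ ?_ (fun _ _ => rfl)
  · rintro ⟨i, w₁, w₂⟩ h
    simp only [Finset.mem_sigma, Finset.mem_product, mem_shuffles] at h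
    obtain ⟨_, ⟨h₁, h₂⟩, h₃, h₄⟩ := h
    simp [mem_shuffles, h₁, h₂, h₃, h₄, hm, not_lt.2 hm]
  · rintro ⟨i, w₁, w₂⟩ h ⟨i', w₁', w₂'⟩ h' e
    simp only [Finset.mem_sigma, Finset.mem_product, Finset.mem_range] at h h'
    obtain ⟨rfl, -, rfl⟩ := List.append_max_cons_inj (hlt h.2.1) (hle h.2.2) (hlt h'.2.1)
      (hle h'.2.2) e
    -- The cut `i` is recovered as the number of small letters before `m`.
    have e₁ := congrArg List.length (mem_shuffles.1 h.2.1).1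
    have e₂ := congrArg List.length (mem_shuffles.1 h'.2.1).1
    rw [e₁, List.length_take, List.length_take] at e₂
    have : i = i' := by omega
    rw [this]
  · intro w hw
    rw [mem_shuffles] at hw
    have hmw : m ∈ w := List.mem_of_mem_filter (hw.2 ▸ by simp : m ∈ w.filter (a ≤ ·))
    obtain ⟨w₁, k, w₂, rfl, h₁, h₂⟩ := List.exists_append_max_cons (List.ne_nil_of_mem hmw)
    have hmk : m ≤ k := by
      rw [List.mem_append, List.mem_cons] at hmw
      rcases hmw with h | h | h
      · exact (h₁ m h).le
      · exact h.le
      · exact h₂ m h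
    obtain ⟨hw, hw'⟩ := hw
    have hk : ¬ k < a := by omega
    have hk' : a ≤ k := by omega
    simp only [List.filter_append, List.filter_cons, hk, hk', decide_false, decide_true, if_true,
      Bool.false_eq_true, if_false] at hw hw'
    -- The greatest letter `k` of the shuffle survives the filter, so it is also the leftmost
    -- greatest letter of `v₁ ++ m :: v₂`.
    obtain ⟨rfl, rfl, rfl⟩ := List.append_max_cons_inj
      (fun x hx => h₁ x (List.mem_of_mem_filter hx)) (fun x hx => h₂ x (List.mem_of_mem_filter hx))
      hv₁ hv₂ hw'
    subst hw
    refine ⟨⟨(w₁.filter (· < a)).length, w₁, w₂⟩, ?_, rfl⟩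
    simp only [Finset.mem_sigma, Finset.mem_product, mem_shuffles, Finset.mem_range,
      List.take_left, List.drop_left, List.length_append, and_self, and_true]
    omega

/-! ### The coproduct of trees is dual to shuffles. -/

namespace PBT

open BinaryTree PlanarTree

/-- The tensor product of two of the functionals `wordCoeff`. -/
def wordCoeffTensor (u v : List ℕ) : PBT ⊗[ℚ] PBT →ₗ[ℚ] ℚ :=
  LinearMap.mul' ℚ ℚ ∘ₗ TensorProduct.map (wordCoeff u) (wordCoeff v)

@[simp]
theorem wordCoeffTensor_tmul (u v : List ℕ) (x y : PBT) :
    wordCoeffTensor u v (x ⊗ₜ y) = wordCoeff u x * wordCoeff v y := rfl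

theorem wordCoeffTensor_nil_mulGraft (u : List ℕ) (a b : PBT ⊗[ℚ] PBT) :
    wordCoeffTensor u [] (mulGraft a b) = 0 := by
  induction a with
  | zero => simp
  | add a a' ha ha' => simp only [map_add, LinearMap.add_apply, ha, ha', add_zero]
  | tmul p q =>
  induction b with
  | zero => simp
  | add a a' ha ha' => simp only [map_add, ha, ha', add_zero]
  | tmul r s => simp [wordCoeff_nil_graft]

theorem wordCoeffTensor_append_cons_mulGraft (u : List ℕ) {v₁ v₂ : List ℕ} {m : ℕ}
    (hv₁ : ∀ x ∈ v₁, x < m) (hv₂ : ∀ x ∈ v₂, x ≤ m) (a b : PBT ⊗[ℚ] PBT) :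
    wordCoeffTensor u (v₁ ++ m :: v₂) (mulGraft a b) =
      ∑ i ∈ Finset.range (u.length + 1),
        wordCoeffTensor (u.take i) v₁ a * wordCoeffTensor (u.drop i) v₂ b := by
  induction a with
  | zero => simp
  | add a a' ha ha' =>
    simp only [map_add, LinearMap.add_apply, ha, ha', add_mul, Finset.sum_add_distrib]
  | tmul p q =>
  induction b with
  | zero => simp
  | add a a' ha ha' => simp only [map_add, ha, ha', mul_add, Finset.sum_add_distrib]
  | tmul r s =>
    rw [mulGraft_tmul, wordCoeffTensor_tmul, wordCoeff_mul,
      wordCoeff_append_cons_graft hv₁ hv₂, Finset.sum_mul]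
    refine Finset.sum_congr rfl fun i _ => ?_
    rw [wordCoeffTensor_tmul, wordCoeffTensor_tmul]
    ring

theorem sum_shuffles_wordCoeff_of (a : ℕ) (T : PlanarTree) : ∀ (u v : List ℕ),
    (∀ x ∈ u, x < a) → (∀ x ∈ v, a ≤ x) →
    ∑ w ∈ shuffles a u v, wordCoeff w (of T) = wordCoeffTensor u v (comul (of T)) := by
  induction T with
  | nil =>
    intro u v hu hv
    rw [of_nil, comul_one, Algebra.TensorProduct.one_def, wordCoeffTensor_tmul]
    simp only [wordCoeff_one]
    by_cases huv : u = [] ∧ v = []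
    · obtain ⟨rfl, rfl⟩ := huv
      rw [shuffles_nil_right (by simp)]
      simp
    · have : (if u = [] then (1 : ℚ) else 0) * (if v = [] then 1 else 0) = 0 := by
        by_cases hu : u = []
        · rw [if_neg fun hv => huv ⟨hu, hv⟩, mul_zero]
        · rw [if_neg hu, zero_mul]
      rw [this]
      refine Finset.sum_eq_zero fun w hw => if_neg ?_
      rintro rfl
      rw [mem_shuffles] at hw
      exact huv ⟨hw.1.symm, hw.2.symm⟩
  | node _ l r hl hr =>
    intro u v hu hv
    rw [← graft_of, comul_graft, map_add, wordCoeffTensor_tmul, wordCoeff_one]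
    -- If `v` is empty, only the term `T ⊗ 1` contributes and `u` is the only shuffle; otherwise
    -- only the `mulGraft` term does, and both sides split at the greatest letter of `v`.
    by_cases hv0 : v = []
    · subst hv0
      rw [shuffles_nil_right hu, Finset.sum_singleton, wordCoeffTensor_nil_mulGraft, if_pos rfl,
        mul_one, add_zero]
    · rw [if_neg hv0, mul_zero, zero_add]
      obtain ⟨v₁, m, v₂, rfl, hv₁, hv₂⟩ := List.exists_append_max_cons hv0
      rw [wordCoeffTensor_append_cons_mulGraft u hv₁ hv₂,
        sum_shuffles_append_cons hu (hv m (by simp)) hv₁ hv₂]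
      refine Finset.sum_congr rfl fun i _ => ?_
      rw [← hl _ _ (fun x hx => hu x (List.mem_of_mem_take hx)) fun x hx => hv x (by simp [hx]),
        ← hr _ _ (fun x hx => hu x (List.mem_of_mem_drop hx)) fun x hx => hv x (by simp [hx]),
        Finset.sum_mul_sum]
      refine Finset.sum_congr rfl fun w₁ hw₁ => Finset.sum_congr rfl fun w₂ hw₂ => ?_
      rw [mem_shuffles] at hw₁ hw₂
      have hle : ∀ {p q v' : List ℕ}, p.filter (· < a) = q → p.filter (a ≤ ·) = v' →
          ∀ x ∈ p, a ≤ x → x ∈ v' := by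
        rintro p q v' - rfl x hx hxa
        exact List.mem_filter.2 ⟨hx, by simpa using hxa⟩
      have hm := hv m (by simp)
      refine wordCoeff_append_cons_graft (fun x hx => ?_) (fun x hx => ?_) _ _
      · by_cases hxa : a ≤ x
        · exact hv₁ x (hle hw₁.1 hw₁.2 x hx hxa)
        · omega
      · by_cases hxa : a ≤ x
        · exact hv₂ x (hle hw₂.1 hw₂.2 x hx hxa)
        · omega

theorem sum_shuffles_wordCoeff {a : ℕ} {u v : List ℕ} (hu : ∀ x ∈ u, x < a)
    (hv : ∀ x ∈ v, a ≤ x) (x : PBT) :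
    ∑ w ∈ shuffles a u v, wordCoeff w x = wordCoeffTensor u v (comul x) := by
  have h : ∑ w ∈ shuffles a u v, wordCoeff w = wordCoeffTensor u v ∘ₗ comul :=
    hom_ext fun T => by
      rw [LinearMap.sum_apply]
      exact sum_shuffles_wordCoeff_of a T u v hu hv
  rw [← LinearMap.comp_apply, ← h, LinearMap.sum_apply]

end PBT

/-! ### Permutations as words -/

/-- The word `(σ(0), …, σ(n - 1))` of a permutation. -/
def Equiv.Perm.word {n : ℕ} (σ : Equiv.Perm (Fin n)) : List ℕ := List.ofFn fun i => (σ i : ℕ)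

/-- The letters of the word `w` are ordered as the values of the permutation `σ`. -/
def List.IsOrderedAs (w : List ℕ) {n : ℕ} (σ : Equiv.Perm (Fin n)) : Prop :=
  w.length = n ∧ ∀ i j : Fin n, w.getD i 0 < w.getD j 0 ↔ σ i < σ j

namespace Equiv.Perm

@[simp]
theorem length_word {n : ℕ} (σ : Equiv.Perm (Fin n)) : σ.word.length = n := by simp [word]

theorem getD_word {n : ℕ} (σ : Equiv.Perm (Fin n)) (i : Fin n) : σ.word.getD i 0 = σ i := by
  simp [word, List.getD_eq_getElem?_getD]

theorem lt_of_mem_word {n : ℕ} (σ : Equiv.Perm (Fin n)) {x : ℕ} (hx : x ∈ σ.word) : x < n := by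
  obtain ⟨i, rfl⟩ := (List.mem_ofFn' _ _).1 hx
  exact (σ i).2

theorem nodup_word {n : ℕ} (σ : Equiv.Perm (Fin n)) : σ.word.Nodup :=
  List.nodup_ofFn.2 (Fin.val_injective.comp σ.injective)

theorem word_injective {n : ℕ} : Function.Injective (word : Equiv.Perm (Fin n) → List ℕ) :=
  fun _ _ h => Equiv.ext fun i => Fin.ext (congrFun (List.ofFn_injective h) i)

theorem sigma_ext_of_word {n m : ℕ} {σ : Equiv.Perm (Fin n)} {τ : Equiv.Perm (Fin m)}
    (h : σ.word = τ.word) :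
    (⟨n, σ⟩ : Σ n : ℕ, Equiv.Perm (Fin n)) = ⟨m, τ⟩ := by
  obtain rfl : n = m := by simpa using congrArg List.length h
  rw [word_injective h]

/-- The composite `σ ∘ τ⁻¹` is an increasing bijection of `Fin n`, hence the identity. -/
theorem eq_of_lt_iff_lt {n : ℕ} {σ τ : Equiv.Perm (Fin n)}
    (h : ∀ i j, σ i < σ j ↔ τ i < τ j) : σ = τ := by
  have hmono : StrictMono (σ ∘ τ.symm) := fun i j hij => by
    rw [Function.comp_apply, Function.comp_apply, h]
    simpa using hij
  have : σ ∘ τ.symm = id := (hmono.range_inj strictMono_id).1 <| by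
    rw [Set.range_id, (σ.surjective.comp τ.symm.surjective).range_eq]
  exact Equiv.ext fun i => by simpa using congrFun this (τ i)

theorem isOrderedAs_word {n m : ℕ} {σ : Equiv.Perm (Fin n)} {τ : Equiv.Perm (Fin m)} :
    σ.word.IsOrderedAs τ ↔ σ.word = τ.word := by
  constructor
  · rintro ⟨h, h'⟩
    obtain rfl : n = m := by simpa using h
    refine congrArg word (eq_of_lt_iff_lt fun i j => ?_)
    have := h' i j
    rwa [getD_word, getD_word, Fin.val_fin_lt] at this
  · intro h
    refine ⟨by rw [h, length_word], fun i j => ?_⟩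
    rw [h, getD_word, getD_word, Fin.val_fin_lt]

theorem exists_word_eq {w : List ℕ} (hw : w.Nodup) (hlt : ∀ x ∈ w, x < w.length) :
    ∃ σ : Equiv.Perm (Fin w.length), σ.word = w := by
  let f : Fin w.length → Fin w.length := fun i => ⟨w[i], hlt _ (List.getElem_mem _)⟩
  have hf : Function.Injective f := fun i j h =>
    Fin.ext ((hw.getElem_inj_iff).1 (Fin.mk.inj_iff.1 h))
  refine ⟨Equiv.ofBijective f (Finite.injective_iff_bijective.1 hf), ?_⟩
  exact List.ofFn_getElem

theorem exists_isOrderedAs {w : List ℕ} (hw : w.Nodup) :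
    ∃ σ : Equiv.Perm (Fin w.length), w.IsOrderedAs σ := by
  let f : Fin w.length → ℕ := fun i => w[i]
  have hf : Function.Injective f := fun i j h => Fin.ext ((hw.getElem_inj_iff).1 h)
  have hmono : StrictMono (f ∘ Tuple.sort f) :=
    (Tuple.monotone_sort f).strictMono_of_injective (hf.comp (Tuple.sort f).injective)
  -- `Tuple.sort f` lists the positions by increasing letter, so its inverse sends a position to the
  -- rank of its letter.
  refine ⟨(Tuple.sort f).symm, rfl, fun i j => ?_⟩
  rw [List.getD_eq_getElem _ _ i.2, List.getD_eq_getElem _ _ j.2, ← hmono.lt_iff_lt]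
  simp [f]

/-- The word formed by the values of a permutation at the positions satisfying a predicate. -/
theorem filter_word {n : ℕ} (σ : Equiv.Perm (Fin n)) (q : ℕ → Prop) [DecidablePred q]
    (s : Finset (Fin n)) (hs : ∀ p, p ∈ s ↔ q (σ p)) :
    σ.word.filter q = List.ofFn fun k => (σ (s.orderEmbOfFin rfl k) : ℕ) := by
  have h₁ : (List.finRange n).filter (fun p => q (σ p)) = s.sort (· ≤ ·) := by
    have hnd : ((List.finRange n).filter (fun p => q (σ p))).Nodup :=
      (List.nodup_finRange n).filter _
    have hfin : ((List.finRange n).filter (fun p => q (σ p))).toFinset = s := by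
      ext p
      simp [hs]
    rw [← hfin]
    refine ((List.toFinset_sort (· ≤ ·) hnd).2 ?_).symm
    exact ((List.pairwise_lt_finRange n).imp fun h => h.le).filter _
  have h₂ : List.ofFn (s.orderEmbOfFin rfl) = s.sort (· ≤ ·) := by
    refine List.ext_getElem (by simp) fun i h h' => ?_
    simp [Finset.orderEmbOfFin_apply]
  calc σ.word.filter q = ((List.finRange n).map fun i => (σ i : ℕ)).filter q := by
        rw [word, List.ofFn_eq_map]
    _ = ((List.finRange n).filter (fun p => q (σ p))).map fun i => (σ i : ℕ) := by
        rw [List.filter_map]; rfl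
    _ = _ := by
        rw [h₁, ← h₂, List.map_ofFn]; rfl

end Equiv.Perm

/-! ### Linearisations are the permutations of a given shape. -/

namespace PlanarTree

open BinaryTree

/-- Among words of the right length the root sits at position `l.numNodes`. Being a shape then says
that letters decrease weakly away from the root, strictness on the left being supplied by
distinctness. -/
theorem isShape_iff_of_nodup {T : PlanarTree} : ∀ {w : List ℕ}, w.Nodup →
    w.length = T.numNodes →
    (IsShape T w ↔ ∀ i < T.numNodes, ∀ j < T.numNodes, le T i j → w.getD j 0 ≤ w.getD i 0) := by
  induction T with
  | nil =>
    intro w _ h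
    simp [IsShape, List.length_eq_zero_iff.1 h]
  | node _ l r hl hr =>
    intro w hw hlen
    simp only [numNodes] at hlen
    obtain ⟨u, m, v, rfl, hu⟩ : ∃ u m v, w = u ++ m :: v ∧ u.length = l.numNodes := by
      refine ⟨w.take l.numNodes, w[l.numNodes]'(by omega), w.drop (l.numNodes + 1), ?_, ?_⟩
      · rw [← List.drop_eq_getElem_cons, List.take_append_drop]
      · rw [List.length_take]; omega
    have hv : v.length = r.numNodes := by
      simp only [List.length_append, List.length_cons] at hlen; omega
    obtain ⟨hnu, hnv, hdisj⟩ := List.nodup_append.1 hw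
    have hnv := (List.nodup_cons.1 hnv).2
    have getu : ∀ i < l.numNodes, (u ++ m :: v).getD i 0 = u.getD i 0 := fun i hi =>
      List.getD_append _ _ _ _ (by omega)
    have getm : (u ++ m :: v).getD l.numNodes 0 = m := by
      rw [List.getD_append_right _ _ _ _ (by omega)]
      simp [hu]
    have getv : ∀ i, (u ++ m :: v).getD (i + (l.numNodes + 1)) 0 = v.getD i 0 := fun i => by
      rw [List.getD_append_right _ _ _ _ (by omega)]
      have : i + (l.numNodes + 1) - u.length = i + 1 := by omega
      rw [this, List.getD_cons_succ]
    have memu : ∀ x ∈ u, ∃ i < l.numNodes, u.getD i 0 = x := fun x hx => by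
      obtain ⟨i, hi, rfl⟩ := List.getElem_of_mem hx
      exact ⟨i, hu ▸ hi, List.getD_eq_getElem _ _ hi⟩
    have memv : ∀ x ∈ v, ∃ i < r.numNodes, v.getD i 0 = x := fun x hx => by
      obtain ⟨i, hi, rfl⟩ := List.getElem_of_mem hx
      exact ⟨i, hv ▸ hi, List.getD_eq_getElem _ _ hi⟩
    have getu_mem : ∀ i < l.numNodes, u.getD i 0 ∈ u := fun i hi => by
      rw [List.getD_eq_getElem _ _ (hu ▸ hi)]
      exact List.getElem_mem _
    have getv_mem : ∀ i < r.numNodes, v.getD i 0 ∈ v := fun i hi => by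
      rw [List.getD_eq_getElem _ _ (hv ▸ hi)]
      exact List.getElem_mem _
    have key : IsShape (node () l r) (u ++ m :: v) ↔
        (∀ x ∈ u, x < m) ∧ (∀ x ∈ v, x ≤ m) ∧ IsShape l u ∧ IsShape r v := by
      constructor
      · rintro ⟨u', m', v', h, hu', hv', hlu, hrv⟩
        -- The left factor of any decomposition has `l.numNodes` letters, so the place of the cut is
        -- forced.
        obtain ⟨rfl, h'⟩ := List.append_inj h (hu.trans hlu.length_eq.symm)
        obtain ⟨rfl, rfl⟩ := List.cons.inj h'
        exact ⟨hu', hv', hlu, hrv⟩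
      · rintro ⟨hu', hv', h⟩
        exact (isShape_node_append_cons hu' hv').2 h
    refine key.trans ?_
    rw [hl hnu hu, hr hnv hv]
    simp only [numNodes]
    constructor
    · rintro ⟨hum, hvm, hlu, hrv⟩ i hi j hj hle
      simp only [le] at hle
      rcases hle with ⟨rfl, -⟩ | ⟨hi, hj, hle⟩ | ⟨hi', hj', hle⟩
      · rw [getm]
        rcases lt_trichotomy j l.numNodes with h | rfl | h
        · rw [getu j h]
          exact (hum _ (getu_mem j h)).le
        · rw [getm]
        · obtain ⟨k, rfl⟩ := Nat.exists_eq_add_of_lt h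
          have e : l.numNodes + k + 1 = k + (l.numNodes + 1) := by omega
          rw [e, getv]
          exact hvm _ (getv_mem k (by omega))
      · rw [getu i hi, getu j hj]
        exact hlu i hi j hj hle
      · obtain ⟨k, rfl⟩ := Nat.exists_eq_add_of_lt hi'
        obtain ⟨k', rfl⟩ := Nat.exists_eq_add_of_lt hj'
        have e : l.numNodes + k + 1 = k + (l.numNodes + 1) := by omega
        have e' : l.numNodes + k' + 1 = k' + (l.numNodes + 1) := by omega
        rw [e, e'] at hle ⊢
        rw [getv, getv]
        rw [Nat.add_sub_cancel, Nat.add_sub_cancel] at hle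
        exact hrv k (by omega) k' (by omega) hle
    · intro h
      refine ⟨fun x hx => ?_, fun x hx => ?_, fun i hi j hj hle => ?_, fun i hi j hj hle => ?_⟩
      · obtain ⟨i, hi, rfl⟩ := memu x hx
        have := h l.numNodes (by omega) i (by omega) (Or.inl ⟨rfl, by omega⟩)
        rw [getm, getu i hi] at this
        exact lt_of_le_of_ne this (hdisj _ hx _ (by simp))
      · obtain ⟨i, hi, rfl⟩ := memv x hx
        have := h l.numNodes (by omega) (i + (l.numNodes + 1)) (by omega)
          (Or.inl ⟨rfl, by omega⟩)
        rwa [getm, getv] at this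
      · have := h i (by omega) j (by omega) ((le_node_left hi hj).2 hle)
        rwa [getu i hi, getu j hj] at this
      · have := h (i + (l.numNodes + 1)) (by omega) (j + (l.numNodes + 1)) (by omega)
          (le_node_right.2 hle)
        rwa [getv, getv] at this

theorem mem_linearisations_iff {T : PlanarTree} {w : List ℕ} (hw : w.Nodup)
    {σ : Equiv.Perm (Fin T.numNodes)} (hσ : w.IsOrderedAs σ) :
    σ ∈ T.linearisations ↔ IsShape T w := by
  classical
  rw [isShape_iff_of_nodup hw hσ.1]
  refine (Finset.mem_filter_univ (p := fun σ => ∀ i j : Fin T.numNodes, le T i j → σ j ≤ σ i)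
    σ).trans ?_
  constructor
  · intro h i hi j hj hle
    rw [← not_lt]
    exact fun hlt => not_lt.2 (h ⟨i, hi⟩ ⟨j, hj⟩ hle) ((hσ.2 ⟨i, hi⟩ ⟨j, hj⟩).1 hlt)
  · intro h i j hle
    rw [← not_lt, ← hσ.2, not_lt]
    exact h i i.2 j j.2 hle

end PlanarTree

/-! ### Coefficients of products and coproducts of permutations. -/

namespace PermAlg

theorem lift_of {M : Type*} [AddCommGroup M] [Module ℚ M]
    (f : (Σ n : ℕ, Equiv.Perm (Fin n)) → M) {n : ℕ} (σ : Equiv.Perm (Fin n)) :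
    lift f (of σ) = f ⟨n, σ⟩ :=
  (Finsupp.linearCombination_single ℚ (1 : ℚ) _).trans (one_smul _ _)

theorem hom_ext {M : Type*} [AddCommGroup M] [Module ℚ M] {f g : PermAlg →ₗ[ℚ] M}
    (h : ∀ (n : ℕ) (σ : Equiv.Perm (Fin n)), f (of σ) = g (of σ)) : f = g :=
  Finsupp.lhom_ext' fun p => LinearMap.ext_ring (h p.1 p.2)

theorem mul_of {n m : ℕ} (σ : Equiv.Perm (Fin n)) (β : Equiv.Perm (Fin m)) :
    mul (of σ) (of β) = permMul σ β := by
  rw [mul, lift_of, lift_of]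

theorem comul_of {n : ℕ} (σ : Equiv.Perm (Fin n)) : comul (of σ) = permComul σ := by
  rw [comul, lift_of]

open Classical in
/-- The sum of the coefficients of the permutations ordered as a given word. -/
def orderCoeff (w : List ℕ) : PermAlg →ₗ[ℚ] ℚ :=
  lift fun σ => if w.IsOrderedAs σ.2 then 1 else 0

open Classical in
theorem orderCoeff_of (w : List ℕ) {n : ℕ} (σ : Equiv.Perm (Fin n)) :
    orderCoeff w (of σ) = if w.IsOrderedAs σ then 1 else 0 := lift_of _ _

theorem orderCoeff_word_of {n m : ℕ} (τ : Equiv.Perm (Fin m)) (σ : Equiv.Perm (Fin n)) :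
    orderCoeff τ.word (of σ) = if τ.word = σ.word then 1 else 0 := by
  classical
  rw [orderCoeff_of]
  exact if_congr Equiv.Perm.isOrderedAs_word rfl rfl

/-- On words of permutations these functionals are the coordinates. Their extension to other words
allows evaluation at factors of a word without standardizing them. -/
theorem orderCoeff_word {m : ℕ} (τ : Equiv.Perm (Fin m)) :
    orderCoeff τ.word = (Finsupp.lapply ⟨m, τ⟩ : _ →ₗ[ℚ] ℚ) := by
  refine hom_ext fun n σ => ?_
  rw [orderCoeff_word_of]
  by_cases h : τ.word = σ.word
  · rw [if_pos h]
    have := Equiv.Perm.sigma_ext_of_word h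
    rw [this]
    exact (Finsupp.single_eq_same (a := (⟨n, σ⟩ : Σ n : ℕ, Equiv.Perm (Fin n)))).symm
  · rw [if_neg h]
    refine (Finsupp.single_eq_of_ne ?_).symm
    intro e
    obtain ⟨rfl, e⟩ := Sigma.mk.inj_iff.1 e
    exact h (congrArg _ (eq_of_heq e))

theorem ext_orderCoeff {x y : PermAlg}
    (h : ∀ (n : ℕ) (τ : Equiv.Perm (Fin n)), orderCoeff τ.word x = orderCoeff τ.word y) : x = y := by
  refine Finsupp.ext fun p => ?_
  have := h p.1 p.2
  rw [orderCoeff_word] at this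
  exact this

/-- The tensor product of two of the functionals `orderCoeff`. -/
def orderCoeffTensor (u v : List ℕ) : PermAlg ⊗[ℚ] PermAlg →ₗ[ℚ] ℚ :=
  LinearMap.mul' ℚ ℚ ∘ₗ TensorProduct.map (orderCoeff u) (orderCoeff v)

@[simp]
theorem orderCoeffTensor_tmul (u v : List ℕ) (x y : PermAlg) :
    orderCoeffTensor u v (x ⊗ₜ y) = orderCoeff u x * orderCoeff v y := rfl

theorem ext_orderCoeffTensor {z z' : PermAlg ⊗[ℚ] PermAlg}
    (h : ∀ (a b : ℕ) (δ : Equiv.Perm (Fin a)) (ε : Equiv.Perm (Fin b)),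
      orderCoeffTensor δ.word ε.word z = orderCoeffTensor δ.word ε.word z') : z = z' := by
  let e : PermAlg ⊗[ℚ] PermAlg ≃ₗ[ℚ] _ :=
    finsuppTensorFinsupp' ℚ (Σ n : ℕ, Equiv.Perm (Fin n)) (Σ n : ℕ, Equiv.Perm (Fin n))
  have he : ∀ (p q : Σ n : ℕ, Equiv.Perm (Fin n)) (z : PermAlg ⊗[ℚ] PermAlg),
      e z (p, q) = orderCoeffTensor p.2.word q.2.word z := by
    intro p q z
    induction z with
    | zero => simp
    | add a b ha hb => rw [map_add, map_add, Finsupp.add_apply, ha, hb]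
    | tmul x y =>
      rw [orderCoeffTensor_tmul, orderCoeff_word, orderCoeff_word]
      exact finsuppTensorFinsupp'_apply_apply _ _ _ x y p q
  refine e.injective (Finsupp.ext fun ⟨p, q⟩ => ?_)
  rw [he, he, h]

theorem isOrderedAs_take_and_drop_word {n m : ℕ} (γ : Equiv.Perm (Fin (n + m)))
    (σ : Equiv.Perm (Fin n)) (β : Equiv.Perm (Fin m)) :
    ((γ.word.take n).IsOrderedAs σ ∧ (γ.word.drop n).IsOrderedAs β) ↔
      (∀ i j : Fin n, γ (Fin.castAdd m i) < γ (Fin.castAdd m j) ↔ σ i < σ j) ∧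
      (∀ i j : Fin m, γ (Fin.natAdd n i) < γ (Fin.natAdd n j) ↔ β i < β j) := by
  have h₁ : ∀ i : Fin n, (γ.word.take n).getD i 0 = γ (Fin.castAdd m i) := fun i => by
    rw [← γ.getD_word, Fin.val_castAdd, List.getD_eq_getElem?_getD, List.getD_eq_getElem?_getD,
      List.getElem?_take_of_lt i.2]
  have h₂ : ∀ i : Fin m, (γ.word.drop n).getD i 0 = γ (Fin.natAdd n i) := fun i => by
    rw [← γ.getD_word, Fin.val_natAdd, List.getD_eq_getElem?_getD, List.getD_eq_getElem?_getD,
      List.getElem?_drop]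
  simp only [List.IsOrderedAs, h₁, h₂, Fin.val_fin_lt, List.length_take, List.length_drop,
    Equiv.Perm.length_word]
  have e₁ : min n (n + m) = n := by omega
  have e₂ : n + m - n = m := by omega
  simp only [e₁, e₂, true_and]

/-- For reasons of length only the cut at `i = n` can contribute, and only if `N = n + m`; there the
two conditions are those defining `permMul`. -/
theorem orderCoeff_permMul {N n m : ℕ} (γ : Equiv.Perm (Fin N)) (σ : Equiv.Perm (Fin n))
    (β : Equiv.Perm (Fin m)) :
    orderCoeff γ.word (permMul σ β) = ∑ i ∈ Finset.range (N + 1),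
      orderCoeff (γ.word.take i) (of σ) * orderCoeff (γ.word.drop i) (of β) := by
  classical
  rw [permMul, map_sum]
  by_cases hN : N = n + m
  · subst hN
    rw [Finset.sum_eq_single_of_mem n (Finset.mem_range.2 (by omega)), orderCoeff_of,
      orderCoeff_of, ite_zero_mul_ite_zero, mul_one,
      if_congr (isOrderedAs_take_and_drop_word γ σ β) rfl rfl]
    · simp only [orderCoeff_word_of, Equiv.Perm.word_injective.eq_iff]
      rw [Finset.sum_ite_eq]
      simp
    · intro i hi hne
      rw [orderCoeff_of, if_neg, zero_mul]
      rintro ⟨h, -⟩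
      rw [List.length_take, γ.length_word] at h
      rw [Finset.mem_range] at hi
      omega
  · rw [Finset.sum_eq_zero, Finset.sum_eq_zero]
    · intro i hi
      rw [orderCoeff_of, orderCoeff_of, ite_zero_mul_ite_zero, if_neg]
      rintro ⟨⟨h, -⟩, ⟨h', -⟩⟩
      rw [List.length_take, γ.length_word] at h
      rw [List.length_drop, γ.length_word] at h'
      rw [Finset.mem_range] at hi
      omega
    · intro τ _
      rw [orderCoeff_word_of, if_neg]
      intro h
      exact hN (by simpa using congrArg List.length h)

theorem orderCoeff_mul {N : ℕ} (γ : Equiv.Perm (Fin N)) (x y : PermAlg) :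
    orderCoeff γ.word (mul x y) = ∑ i ∈ Finset.range (N + 1),
      orderCoeff (γ.word.take i) x * orderCoeff (γ.word.drop i) y := by
  have h : mul.compr₂ (orderCoeff γ.word) = ∑ i ∈ Finset.range (N + 1),
      (LinearMap.mul ℚ ℚ).compl₁₂ (orderCoeff (γ.word.take i)) (orderCoeff (γ.word.drop i)) := by
    refine hom_ext fun n σ => hom_ext fun m β => ?_
    simpa [LinearMap.sum_apply, mul_of] using orderCoeff_permMul γ σ β
  simpa [LinearMap.sum_apply] using LinearMap.congr_fun₂ h x y

theorem orderEmbOfFin_standardize {n : ℕ} (σ : Equiv.Perm (Fin n)) (s : Finset (Fin n))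
    (k : Fin s.card) :
    (s.map σ.toEmbedding).orderEmbOfFin (Finset.card_map _) (standardize σ s k) =
      σ (s.orderEmbOfFin rfl k) := by
  rw [← Finset.coe_orderIsoOfFin_apply]
  simp [standardize]

/-- If the values of `σ` at the positions in `s` are the integers of an interval `[c, c + |s|)`,
then standardization subtracts `c`. -/
theorem standardize_add {n : ℕ} (σ : Equiv.Perm (Fin n)) (s : Finset (Fin n)) (c : ℕ)
    (hs : ∀ p, p ∈ s ↔ c ≤ (σ p : ℕ) ∧ (σ p : ℕ) < c + s.card) (hn : c + s.card ≤ n)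
    (k : Fin s.card) :
    (standardize σ s k : ℕ) + c = σ (s.orderEmbOfFin rfl k) := by
  -- The values form an interval starting at `c`, so by uniqueness their increasing enumeration is
  -- `k ↦ k + c`.
  have h : (fun k : Fin s.card => (⟨k + c, by omega⟩ : Fin n)) =
      (s.map σ.toEmbedding).orderEmbOfFin (Finset.card_map _) := by
    refine Finset.orderEmbOfFin_unique _ (fun k => ?_) fun i j hij => ?_
    · rw [Finset.mem_map_equiv, hs, Equiv.apply_symm_apply]
      exact ⟨by simp, by simp only; omega⟩
    · exact Fin.mk_lt_mk.2 (Nat.add_lt_add_right hij c)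
  rw [← orderEmbOfFin_standardize, ← h]

theorem card_filter_lt {n : ℕ} (σ : Equiv.Perm (Fin n)) {i : ℕ} (hi : i ≤ n) :
    ({p | (σ p : ℕ) < i} : Finset (Fin n)).card = i := by
  have : ({p | (σ p : ℕ) < i} : Finset (Fin n)) =
      (Finset.univ.filter fun p : Fin n => (p : ℕ) < i).map σ.symm.toEmbedding := by
    ext p
    simp [Finset.mem_map_equiv]
  rw [this, Finset.card_map, Fin.card_filter_val_lt, min_eq_right hi]

theorem card_filter_le {n : ℕ} (σ : Equiv.Perm (Fin n)) {i : ℕ} (hi : i ≤ n) :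
    ({p | i ≤ (σ p : ℕ)} : Finset (Fin n)).card = n - i := by
  have h := Finset.card_filter_add_card_filter_not (s := (Finset.univ : Finset (Fin n)))
    (fun p => (σ p : ℕ) < i)
  simp only [not_lt] at h
  rw [card_filter_lt σ hi, Finset.card_univ, Fintype.card_fin] at h
  omega

theorem word_standardize_lt {n : ℕ} (σ : Equiv.Perm (Fin n)) {i : ℕ} (hi : i ≤ n) :
    (standardize σ {p | (σ p : ℕ) < i}).word = σ.word.filter (· < i) := by
  rw [σ.filter_word (· < i) {p | (σ p : ℕ) < i} (by simp), Equiv.Perm.word]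
  congr 1
  funext k
  refine standardize_add σ {p | (σ p : ℕ) < i} 0 (fun p => ?_) ?_ k
  · rw [card_filter_lt σ hi]
    simp
  · rw [card_filter_lt σ hi]
    omega

theorem word_standardize_le {n : ℕ} (σ : Equiv.Perm (Fin n)) {i : ℕ} (hi : i ≤ n) :
    (standardize σ {p | i ≤ (σ p : ℕ)}).word.map (· + i) = σ.word.filter (i ≤ ·) := by
  rw [σ.filter_word (i ≤ ·) {p | i ≤ (σ p : ℕ)} (by simp), Equiv.Perm.word, List.map_ofFn]
  congr 1
  funext k
  refine standardize_add σ {p | i ≤ (σ p : ℕ)} i (fun p => ?_) ?_ k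
  · rw [card_filter_le σ hi]
    have := (σ p).2
    simp only [Finset.mem_filter, Finset.mem_univ, true_and]
    omega
  · rw [card_filter_le σ hi]
    omega

/-- The left factor of the `i`-th term is a permutation of `i` letters, so only `i = a` can match
`δ`; the match means that `σ.word` is a shuffle of `δ` with the shifted `ε`. -/
theorem orderCoeffTensor_permComul {n a b : ℕ} (σ : Equiv.Perm (Fin n))
    (δ : Equiv.Perm (Fin a)) (ε : Equiv.Perm (Fin b)) :
    orderCoeffTensor δ.word ε.word (permComul σ) =
      if σ.word ∈ shuffles a δ.word (ε.word.map (· + a)) then 1 else 0 := by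
  have hterm : ∀ i ≤ n, orderCoeffTensor δ.word ε.word
      (of (standardize σ {p | (σ p : ℕ) < i}) ⊗ₜ[ℚ] of (standardize σ {p | i ≤ (σ p : ℕ)})) =
      if δ.word = σ.word.filter (· < i) ∧ ε.word.map (· + i) = σ.word.filter (i ≤ ·)
        then 1 else 0 := by
    intro i hi
    have hinj : Function.Injective (List.map (· + i)) :=
      List.map_injective_iff.2 (add_left_injective i)
    rw [orderCoeffTensor_tmul, orderCoeff_word_of, orderCoeff_word_of, ite_zero_mul_ite_zero, mul_one,
      ← word_standardize_lt σ hi, ← word_standardize_le σ hi]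
    exact if_congr (and_congr_right' hinj.eq_iff.symm) rfl rfl
  rw [permComul, map_sum]
  by_cases ha : a ≤ n
  · rw [Finset.sum_eq_single_of_mem a (Finset.mem_range.2 (by omega)), hterm a ha]
    · exact if_congr (by rw [mem_shuffles, eq_comm, @eq_comm _ (List.map _ _)]) rfl rfl
    · intro i hi hne
      have hi : i ≤ n := by rw [Finset.mem_range] at hi; omega
      rw [hterm i hi, if_neg]
      rintro ⟨h, -⟩
      rw [← word_standardize_lt σ hi] at h
      have := congrArg List.length h
      rw [Equiv.Perm.length_word, Equiv.Perm.length_word, card_filter_lt σ hi] at this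
      exact hne this.symm
  · rw [Finset.sum_eq_zero, if_neg]
    · rw [mem_shuffles]
      rintro ⟨h, -⟩
      have h₁ := congrArg List.length h
      have h₂ := List.length_filter_le (fun x => decide (x < a)) σ.word
      rw [Equiv.Perm.length_word] at h₁ h₂
      omega
    · intro i hi
      have hi : i ≤ n := by rw [Finset.mem_range] at hi; omega
      rw [hterm i hi, if_neg]
      rintro ⟨h, -⟩
      have h₁ := congrArg List.length h
      have h₂ := List.length_filter_le (fun x => decide (x < i)) σ.word
      rw [Equiv.Perm.length_word] at h₁ h₂
      omega

theorem exists_word_eq_of_mem_shuffles {a b : ℕ} {δ : Equiv.Perm (Fin a)}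
    {ε : Equiv.Perm (Fin b)} {w : List ℕ} (hw : w ∈ shuffles a δ.word (ε.word.map (· + a))) :
    ∃ τ : Equiv.Perm (Fin w.length), τ.word = w := by
  have hperm : (δ.word ++ ε.word.map (· + a)).Perm w := by
    rw [shuffles, Finset.mem_filter, List.mem_toFinset, List.mem_permutations] at hw
    exact hw.1.symm
  have hlen : w.length = a + b := by
    rw [← hperm.length_eq]
    simp
  refine Equiv.Perm.exists_word_eq (hperm.nodup_iff.1 ?_) fun x hx => ?_
  · rw [List.nodup_append]
    refine ⟨δ.nodup_word, ε.nodup_word.map (add_left_injective a), ?_⟩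
    rintro x hx y hy rfl
    obtain ⟨z, -, rfl⟩ := List.mem_map.1 hy
    have := δ.lt_of_mem_word hx
    omega
  · rw [hlen]
    rw [← hperm.mem_iff, List.mem_append] at hx
    rcases hx with hx | hx
    · have := δ.lt_of_mem_word hx
      omega
    · obtain ⟨z, hz, rfl⟩ := List.mem_map.1 hx
      have := ε.lt_of_mem_word hz
      omega

theorem orderCoeffTensor_comul {a b : ℕ} (δ : Equiv.Perm (Fin a)) (ε : Equiv.Perm (Fin b))
    (x : PermAlg) :
    orderCoeffTensor δ.word ε.word (comul x) =
      ∑ w ∈ shuffles a δ.word (ε.word.map (· + a)), orderCoeff w x := by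
  have h : orderCoeffTensor δ.word ε.word ∘ₗ comul =
      ∑ w ∈ shuffles a δ.word (ε.word.map (· + a)), orderCoeff w := by
    refine hom_ext fun n σ => ?_
    rw [LinearMap.comp_apply, comul_of, orderCoeffTensor_permComul, LinearMap.sum_apply]
    have : ∀ w ∈ shuffles a δ.word (ε.word.map (· + a)),
        orderCoeff w (of σ) = if w = σ.word then 1 else 0 := fun w hw => by
      obtain ⟨τ, hτ⟩ := exists_word_eq_of_mem_shuffles hw
      rw [← hτ, orderCoeff_word_of]
    rw [Finset.sum_congr rfl this, Finset.sum_ite_eq']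
  rw [← LinearMap.comp_apply, h, LinearMap.sum_apply]

end PermAlg

/-! ### The embedding of trees into permutations. -/

namespace PBT

open BinaryTree PlanarTree

theorem kappa_of (T : PlanarTree) : kappa (of T) = ∑ σ ∈ T.linearisations, PermAlg.of σ :=
  lift_of _ _

/-- A word with distinct letters is ordered as exactly one permutation, and this one is a
linearisation of `T` precisely when the word has shape `T`. -/
theorem orderCoeff_kappa_of {w : List ℕ} (hw : w.Nodup) (T : PlanarTree) :
    PermAlg.orderCoeff w (kappa (of T)) = wordCoeff w (of T) := by
  classical
  rw [kappa_of, map_sum, wordCoeff_of]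
  by_cases hlen : w.length = T.numNodes
  · obtain ⟨τ, hτ⟩ : ∃ τ : Equiv.Perm (Fin T.numNodes), w.IsOrderedAs τ :=
      hlen ▸ Equiv.Perm.exists_isOrderedAs hw
    have huniq : ∀ σ : Equiv.Perm (Fin T.numNodes), w.IsOrderedAs σ ↔ τ = σ := fun σ => by
      constructor
      · exact fun hσ => Equiv.Perm.eq_of_lt_iff_lt fun i j => (hτ.2 i j).symm.trans (hσ.2 i j)
      · rintro rfl
        exact hτ
    simp only [PermAlg.orderCoeff_of]
    rw [Finset.sum_congr rfl fun σ _ => if_congr (huniq σ) rfl rfl, Finset.sum_ite_eq]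
    exact if_congr (mem_linearisations_iff hw hτ) rfl rfl
  · rw [if_neg fun h => hlen h.length_eq]
    refine Finset.sum_eq_zero fun σ _ => ?_
    rw [PermAlg.orderCoeff_of, if_neg fun h => hlen h.1]

theorem orderCoeff_kappa {w : List ℕ} (hw : w.Nodup) (x : PBT) :
    PermAlg.orderCoeff w (kappa x) = wordCoeff w x := by
  have h : PermAlg.orderCoeff w ∘ₗ kappa = wordCoeff w := hom_ext (orderCoeff_kappa_of hw)
  exact LinearMap.congr_fun h x

theorem kappa_injective : Function.Injective kappa := by
  intro x y hxy
  refine Finsupp.ext fun T => ?_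
  obtain ⟨w, hw, -, hT⟩ := exists_nodup_isShape T
  -- As a word has at most one shape, `wordCoeff w` reads off the coefficient of `T`.
  have h : wordCoeff w = (Finsupp.lapply T : _ →ₗ[ℚ] ℚ) := hom_ext fun U => by
    rw [wordCoeff_of]
    by_cases hU : IsShape U w
    · rw [if_pos hU, hU.unique hT]
      exact (Finsupp.single_eq_same (a := T)).symm
    · rw [if_neg hU]
      refine (Finsupp.single_eq_of_ne ?_).symm
      rintro rfl
      exact hU hT
  have := congrArg (PermAlg.orderCoeff w) hxy
  rw [orderCoeff_kappa hw, orderCoeff_kappa hw, h] at this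
  exact this

theorem kappa_one : kappa 1 = PermAlg.one := by
  refine PermAlg.ext_orderCoeff fun n τ => ?_
  rw [orderCoeff_kappa τ.nodup_word, wordCoeff_one, PermAlg.one, PermAlg.orderCoeff_word_of]
  rfl

theorem kappa_mul (x y : PBT) : kappa (x * y) = PermAlg.mul (kappa x) (kappa y) := by
  refine PermAlg.ext_orderCoeff fun n τ => ?_
  rw [orderCoeff_kappa τ.nodup_word, wordCoeff_mul, PermAlg.orderCoeff_mul, τ.length_word]
  refine Finset.sum_congr rfl fun i _ => ?_
  rw [orderCoeff_kappa (τ.nodup_word.sublist (List.take_sublist _ _)),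
    orderCoeff_kappa (τ.nodup_word.sublist (List.drop_sublist _ _))]

/-- The coefficient at `δ ⊗ ε` is, on both sides, a sum over the shuffles of `δ` with `ε` shifted by
`a`. These are again words of permutations, hence have distinct letters, and `orderCoeff_kappa`
applies to each of them. -/
theorem map_kappa_comul (x : PBT) :
    TensorProduct.map kappa kappa (comul x) = PermAlg.comul (kappa x) := by
  refine PermAlg.ext_orderCoeffTensor fun a b δ ε => ?_
  have hleft : ∀ z : PBT ⊗[ℚ] PBT,
      PermAlg.orderCoeffTensor δ.word ε.word (TensorProduct.map kappa kappa z) =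
        wordCoeffTensor δ.word (ε.word.map (· + a)) z := fun z => by
    induction z with
    | zero => simp
    | add z z' h h' => simp only [map_add, h, h']
    | tmul p q =>
      rw [TensorProduct.map_tmul, PermAlg.orderCoeffTensor_tmul, wordCoeffTensor_tmul,
        orderCoeff_kappa δ.nodup_word, orderCoeff_kappa ε.nodup_word, wordCoeff_map_add]
  rw [hleft, ← sum_shuffles_wordCoeff (fun x hx => δ.lt_of_mem_word hx) (by simp),
    PermAlg.orderCoeffTensor_comul]
  refine Finset.sum_congr rfl fun w hw => ?_
  obtain ⟨τ, hτ⟩ := PermAlg.exists_word_eq_of_mem_shuffles hw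
  rw [orderCoeff_kappa (hτ ▸ τ.nodup_word)]

end PBT

end

theorem mainTheorem10 :
    (Function.Injective PBT.kappa ∧ PBT.kappa 1 = PermAlg.one ∧
      ∀ x y : PBT, PBT.kappa (x * y) = PermAlg.mul (PBT.kappa x) (PBT.kappa y)) ∧
    ∃ Δ : PBT →ₗ[ℚ] PBT ⊗[ℚ] PBT,
      (∀ x : PBT,
        TensorProduct.map PBT.kappa PBT.kappa (Δ x) = PermAlg.comul (PBT.kappa x)) ∧
      IsHopfCoproduct Δ ∧
      (∀ T : PlanarTree, T ≠ BinaryTree.nil →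
        Δ (PBT.of T) = PBT.of T ⊗ₜ[ℚ] (1 : PBT) +
          ∑ V ∈ T.admissible, PBT.prunedProduct T V ⊗ₜ[ℚ] PBT.of (T.trunk V)) ∧
      IsHopfCoproduct ((TensorProduct.comm ℚ PBT PBT).toLinearMap ∘ₗ Δ) ∧
      (∀ T : PlanarTree, T ≠ BinaryTree.nil →
        TensorProduct.comm ℚ PBT PBT (Δ (PBT.of T)) = (1 : PBT) ⊗ₜ[ℚ] PBT.of T +
          ∑ V ∈ T.admissible, PBT.of (T.trunk V) ⊗ₜ[ℚ] PBT.prunedProduct T V) := by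
  refine ⟨⟨PBT.kappa_injective, PBT.kappa_one, PBT.kappa_mul⟩, PBT.comul, PBT.map_kappa_comul,
    PBT.isHopfCoproduct_comul, PBT.comul_of_eq_sum_admissible,
    PBT.isHopfCoproduct_comm_comp_comul, fun T hT => ?_⟩
  rw [PBT.comul_of_eq_sum_admissible T hT, map_add, map_sum, TensorProduct.comm_tmul]
  simp only [TensorProduct.comm_tmul]
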